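/- Let $V$ be a finite-dimensional Euclidean space and let $W\subset O(V)$ be a finite reflection group, i.e. a finite group generated by orthogonal reflections (in hyperplanes). Let $C$ be a fundamental cone of $W$, i.e. the closure of a connected component of the complement of the union of the mirrors (reflecting hyperplanes) of $W$. For a polyhedral cone $K$ let $\langle K\rangle$ be its linear span and $\sigma(K)=\operatorname{vol}(K\cap B)/\operatorname{vol}(B)$, with $B$ the unit ball of $\langle K\rangle$, its relative angle measure. For a face $F$ of $C$ let $C/F$ be the orthogonal projection of $C$ to $\langle F\rangle^\perp$, and let $(C/F)^*=\{v\in\langle F\rangle^\perp : (v,u)\ge 0\ \forall u\in C/F\}$ be its dual cone in $\langle F\rangle^\perp$. Let $W_F$ be the subgroup of $W$ fixing $\langle F\rangle$ pointwise, $W_F^{\mathrm{reg}}$ the set of elements of $W_F$ that have no nonzero fixed vector in $\langle F\rangle^\perp$, and $N_F=\{w\in W: w\langle F\rangle=\langle F\rangle\}$. For $k\ge 0$ put $W^k=\{w\in W:\dim\ker(1-w)=k\}$. Call two $k$-dimensional faces $F,F'$ of $C$ equivalent, $F\sim F'$, if $w\langle F\rangle=\langle F'\rangle$ for some $w\in W$.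 Then $C$ has only finitely many $k$-dimensional faces, and: 1. for every $k$-dimensional face $F$ of $C$, $$\sum_{F'\sim F}\sigma(F')=\frac{|W_F|}{|N_F|},$$ where $F'$ runs over the $k$-dimensional faces of $C$ equivalent to $F$; 2. if $F$ runs over a set of representatives of the equivalence classes of $k$-dimensional faces of $C$, then $$\sum_{F}\frac{|W_F^{\mathrm{reg}}|}{|N_F|}=\sum_F\Big(\sum_{F'\sim F}\sigma(F')\Big)\,\sigma\big((C/F)^*\big)=\frac{|W^k|}{|W|}.$$ -/

import Mathlib

open MeasureTheory
open scoped RealInnerProductSpace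

noncomputable section

namespace AngleMeasure

variable {E : Type*} [NormedAddCommGroup E] [InnerProductSpace ℝ E] [FiniteDimensional ℝ E]

/-! ### Angle measures of cones -/

/-- The proportion of the unit ball of a Euclidean space that is occupied by a set. -/
def ballFraction [MeasurableSpace E] [BorelSpace E] (S : Set E) : ℝ :=
  (volume (S ∩ Metric.closedBall (0 : E) 1)).toReal / (volume (Metric.closedBall (0 : E) 1)).toReal

/-- The linear span of a cone. -/
def linSpan (C : PointedCone ℝ E) : Submodule ℝ E := Submodule.span ℝ (C : Set E)

/-- The relative angle measure of a cone: the proportion that it occupies of the unit ball of its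
own linear span. -/
def relAngle [MeasurableSpace E] [BorelSpace E] (C : PointedCone ℝ E) : ℝ :=
  ballFraction {x : linSpan C | (x : E) ∈ C}

/-- The cone `C / F`: the orthogonal projection of `C` to the orthogonal complement of the span
of `F`. -/
def quotCone (C F : PointedCone ℝ E) : PointedCone ℝ (linSpan F)ᗮ :=
  PointedCone.map ((linSpan F)ᗮ.orthogonalProjectionOnto : E →ₗ[ℝ] (linSpan F)ᗮ) C

/-- The dual cone `{v | ⟪v, u⟫ ≥ 0 for all u ∈ C}`. -/
def dualCone (C : PointedCone ℝ E) : PointedCone ℝ E :=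
  (ProperCone.innerDual (C : Set E) : ProperCone ℝ E).toSubmodule

/-! ### Finite reflection groups -/

/-- The orthogonal reflection in the hyperplane orthogonal to `v` (for `v ≠ 0`). -/
abbrev refl (v : E) : E ≃ₗᵢ[ℝ] E := (ℝ ∙ v)ᗮ.reflection

/-- A finite group of isometries that is generated by reflections. -/
structure IsFiniteReflectionGroup (W : Subgroup (E ≃ₗᵢ[ℝ] E)) : Prop where
  finite : Finite W
  generated : ∃ S : Set (E ≃ₗᵢ[ℝ] E), (∀ s ∈ S, ∃ v : E, v ≠ 0 ∧ s = refl v) ∧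
    W = Subgroup.closure S

/-- The complement of the union of the mirrors of `W`. -/
def mirrorCompl (W : Subgroup (E ≃ₗᵢ[ℝ] E)) : Set E :=
  {x | ∀ v : E, v ≠ 0 → refl v ∈ W → ⟪v, x⟫ ≠ 0}

/-- `C` is a fundamental cone of `W` (a closed chamber): for some point `x` on no mirror, `C`
consists of the points that lie on the same closed side as `x` of every mirror. -/
def IsFundamentalCone (W : Subgroup (E ≃ₗᵢ[ℝ] E)) (C : PointedCone ℝ E) : Prop :=
  ∃ x ∈ mirrorCompl W, ∀ y : E, y ∈ C ↔ ∀ v : E, refl v ∈ W → 0 ≤ ⟪v, x⟫ * ⟪v, y⟫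

/-- Fundamental cones are the closures of the connected components of the complement of the
mirrors. -/
theorem isFundamentalCone_iff (W : Subgroup (E ≃ₗᵢ[ℝ] E)) (C : PointedCone ℝ E) :
    IsFundamentalCone W C ↔
      ∃ x ∈ mirrorCompl W, (C : Set E) = closure (connectedComponentIn (mirrorCompl W) x) := by
  have key : ∀ x ∈ mirrorCompl W, closure (connectedComponentIn (mirrorCompl W) x) =
      {y | ∀ v : E, refl v ∈ W → 0 ≤ ⟪v, x⟫ * ⟪v, y⟫} := by
    intro x hx
    have hcomp : connectedComponentIn (mirrorCompl W) x =
        {y | ∀ v : E, v ≠ 0 → refl v ∈ W → 0 < ⟪v, x⟫ * ⟪v, y⟫} := by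
      apply Set.Subset.antisymm
      · intro y hy v hv hvW
        by_contra hneg
        have hpre := isPreconnected_connectedComponentIn (x := x) (F := mirrorCompl W)
        have hxm := mem_connectedComponentIn hx
        have hc : ContinuousOn (fun z : E => ⟪v, x⟫ * ⟪v, z⟫)
            (connectedComponentIn (mirrorCompl W) x) := by fun_prop
        have h0 : (0 : ℝ) ∈ Set.Icc (⟪v, x⟫ * ⟪v, y⟫) (⟪v, x⟫ * ⟪v, x⟫) :=
          ⟨not_lt.mp hneg, mul_self_nonneg _⟩
        obtain ⟨z, hz, hz0⟩ := hpre.intermediate_value hy hxm hc h0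
        rcases mul_eq_zero.mp hz0 with h | h
        · exact hx v hv hvW h
        · exact connectedComponentIn_subset _ _ hz v hv hvW h
      · apply IsPreconnected.subset_connectedComponentIn
        · refine Convex.isPreconnected ?_
          intro y hy z hz a b ha hb hab v hv hvW
          have h1 := hy v hv hvW
          have h2 := hz v hv hvW
          rw [inner_add_right, real_inner_smul_right, real_inner_smul_right]
          rcases ha.eq_or_lt with rfl | ha'
          · have : b = 1 := by linarith
            subst this
            simpa using h2
          · nlinarith [mul_pos ha' h1, mul_nonneg hb h2.le]
        · exact fun v hv hvW => mul_self_pos.mpr (hx v hv hvW)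
        · intro y hy v hv hvW h
          have := hy v hv hvW
          rw [h, mul_zero] at this
          exact lt_irrefl _ this
    rw [hcomp]
    apply Set.Subset.antisymm
    · apply closure_minimal
      · intro y hy v hvW
        by_cases hv : v = 0
        · simp [hv]
        · exact (hy v hv hvW).le
      · have : {y | ∀ v : E, refl v ∈ W → 0 ≤ ⟪v, x⟫ * ⟪v, y⟫} =
            ⋂ v : E, ⋂ _ : refl v ∈ W, {y | 0 ≤ ⟪v, x⟫ * ⟪v, y⟫} := by
          ext y; simp
        rw [this]
        exact isClosed_iInter fun v => isClosed_iInter fun _ =>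
          isClosed_le continuous_const (by fun_prop)
    · intro y hy
      have hc : Filter.Tendsto (fun t : ℝ => y + t • x) (nhdsWithin 0 (Set.Ioi 0)) (nhds y) := by
        have : Filter.Tendsto (fun t : ℝ => y + t • x) (nhds 0) (nhds (y + (0 : ℝ) • x)) :=
          Continuous.tendsto (by fun_prop) 0
        rw [zero_smul, add_zero] at this
        exact this.mono_left nhdsWithin_le_nhds
      refine mem_closure_of_tendsto hc ?_
      filter_upwards [self_mem_nhdsWithin] with t ht v hv hvW
      have h1 := hy v hvW
      have h2 := mul_pos (Set.mem_Ioi.mp ht) (mul_self_pos.mpr (hx v hv hvW))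
      rw [inner_add_right, real_inner_smul_right]
      nlinarith
  refine exists_congr fun x => and_congr_right fun hx => ?_
  rw [key x hx, Set.ext_iff]
  rfl

/-- The fixed space `ker (1 - w)`. -/
def fixedSpace (w : E ≃ₗᵢ[ℝ] E) : Submodule ℝ E :=
  LinearMap.ker (LinearMap.id - (w.toLinearEquiv : E →ₗ[ℝ] E))

/-- `W^k`: the elements of `W` whose fixed space has dimension `k`. -/
def fixDimSet (W : Subgroup (E ≃ₗᵢ[ℝ] E)) (k : ℕ) : Set (E ≃ₗᵢ[ℝ] E) :=
  {w | w ∈ W ∧ Module.finrank ℝ (fixedSpace w) = k}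

/-- `W_U`: the subgroup of `W` that fixes the subspace `U` pointwise. -/
def pointFixer (W : Subgroup (E ≃ₗᵢ[ℝ] E)) (U : Submodule ℝ E) : Subgroup (E ≃ₗᵢ[ℝ] E) where
  carrier := {w | w ∈ W ∧ ∀ u ∈ U, w u = u}
  one_mem' := ⟨W.one_mem, fun _ _ => rfl⟩
  mul_mem' := fun {a b} ha hb => ⟨W.mul_mem ha.1 hb.1, fun u hu => by
    change a (b u) = u
    rw [hb.2 u hu, ha.2 u hu]⟩
  inv_mem' := fun {a} ha => ⟨W.inv_mem ha.1, fun u hu => by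
    conv_lhs => rw [← ha.2 u hu]
    exact a.symm_apply_apply u⟩

/-- The regular elements of `W_U`, a reflection group that is regarded as acting on the orthogonal
complement of `U`: the elements of `W_U` without nonzero fixed vectors in that complement. -/
def regSet (W : Subgroup (E ≃ₗᵢ[ℝ] E)) (U : Submodule ℝ E) : Set (E ≃ₗᵢ[ℝ] E) :=
  {w | w ∈ pointFixer W U ∧ fixedSpace w ⊓ Uᗮ = ⊥}

/-- The image `w U` of a subspace. -/
abbrev image (w : E ≃ₗᵢ[ℝ] E) (U : Submodule ℝ E) : Submodule ℝ E :=
  U.map (w.toLinearEquiv : E →ₗ[ℝ] E)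

/-- The subgroup of `W` that maps the subspace `U` onto itself. -/
def normalizer (W : Subgroup (E ≃ₗᵢ[ℝ] E)) (U : Submodule ℝ E) : Subgroup (E ≃ₗᵢ[ℝ] E) where
  carrier := {w | w ∈ W ∧ image w U = U}
  one_mem' := ⟨W.one_mem, Submodule.map_id U⟩
  mul_mem' := fun {a b} ha hb => ⟨W.mul_mem ha.1 hb.1, by
    have h : image (a * b) U = image a (image b U) := Submodule.map_comp _ _ U
    rw [h, hb.2, ha.2]⟩
  inv_mem' := fun {a} ha => ⟨W.inv_mem ha.1, by
    have h : image (a⁻¹ * a) U = image a⁻¹ (image a U) := Submodule.map_comp _ _ U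
    rw [ha.2, inv_mul_cancel] at h
    exact h.symm.trans (Submodule.map_id U)⟩

/-! ### Faces -/

/-- The `k`-dimensional faces of a cone. -/
def faces (C : PointedCone ℝ E) (k : ℕ) : Set (PointedCone ℝ E) :=
  {F | F.IsFaceOf C ∧ Module.finrank ℝ (linSpan F) = k}

/-- Two faces are equivalent if some element of `W` maps the linear span of the first onto the
linear span of the second. -/
def FaceEquiv (W : Subgroup (E ≃ₗᵢ[ℝ] E)) (F F' : PointedCone ℝ E) : Prop :=
  ∃ w ∈ W, image w (linSpan F) = linSpan F'

/-- `R` contains exactly one representative of every equivalence class of `k`-dimensional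
faces of `C`. -/
def IsFaceTransversal (W : Subgroup (E ≃ₗᵢ[ℝ] E)) (C : PointedCone ℝ E) (k : ℕ)
    (R : Finset (PointedCone ℝ E)) : Prop :=
  (∀ F ∈ R, F ∈ faces C k) ∧ ∀ F ∈ faces C k, ∃! F', F' ∈ R ∧ FaceEquiv W F F'

/-- The sum of the relative angle measures of the faces of `C` that are equivalent to `F`. -/
def classAngle [MeasurableSpace E] [BorelSpace E] (W : Subgroup (E ≃ₗᵢ[ℝ] E))
    (C F : PointedCone ℝ E) (k : ℕ) : ℝ :=
  ∑ᶠ F' ∈ {F' | F' ∈ faces C k ∧ FaceEquiv W F F'}, relAngle F'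

end AngleMeasure

end

/-!
A chamber `C` is a strict fundamental domain of `W`, and the stabilizer of a point is generated by
the reflections in the mirrors through it. Hence, for almost every `u` in the span of a face `F`,
the `w ∈ W` with `w u ∈ C` form a coset of `W_F`, and such a `w` maps the span of `F` onto the span
of the face that contains `w u`. Integrating over the unit ball of the span of `F` yields
`|N_F| * ∑ σ(F') = |W_F|`.

Mapping a vector to its representative in `C` is nonexpansive. Therefore, if `v` is interior to the
dual cone `C*`, the map `x ↦` (representative of `x - v`) has a fixed point in `C`, that is,
`v = x - w x` with `x ∈ C` and `w ∈ W`; conversely `x - w x ∈ C*` for all `x ∈ C`. For generic `v`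
the pair `(x, w)` is unique and `w` is regular. On the other hand every regular `w` writes `v` as
`x - w x` for a unique `x`, which lies in a unique chamber, so that `v` lies in exactly as many
translates of `C*` as there are regular elements: `|W| σ(C*) = |W^reg|`. Since `C / F` is a chamber
of `W_F` acting on the orthogonal complement of `F`, also `|W_F| σ((C / F)*) = |W_F^reg|`.

The fixed space of every element of `W` is a translate of the span of a face, so counting pairs
`(w, g)` with `g` mapping the span of `F` onto the fixed space of `w` gives the last equality.
-/

noncomputable section

namespace AngleMeasure

section Reflections

variable {E : Type*} [NormedAddCommGroup E] [InnerProductSpace ℝ E]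

theorem refl_apply (v x : E) : refl v x = x - (2 * (⟪v, x⟫ / ‖v‖ ^ 2)) • v := by
  rw [Submodule.reflection_orthogonal_apply, Submodule.reflection_singleton_apply]
  simp [mul_smul, two_smul]

theorem refl_apply_of_norm_eq_one {v : E} (hv : ‖v‖ = 1) (x : E) :
    refl v x = x - (2 * ⟪v, x⟫) • v := by
  simp [refl_apply, hv]

theorem refl_self (v : E) : refl v v = -v :=
  Submodule.reflection_orthogonalComplement_singleton_eq_neg v

theorem refl_eq_self_iff (v x : E) : refl v x = x ↔ ⟪v, x⟫ = 0 := by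
  rw [Submodule.reflection_eq_self_iff, Submodule.mem_orthogonal_singleton_iff_inner_right]

theorem refl_smul {c : ℝ} (hc : c ≠ 0) (v : E) : refl (c • v) = refl v := by
  simp only [refl, Submodule.span_singleton_smul_eq (IsUnit.mk0 c hc) v]

theorem refl_neg (v : E) : refl (-v) = refl v := by
  rw [← neg_one_smul ℝ, refl_smul (neg_ne_zero.mpr one_ne_zero)]

theorem inner_refl_left (v x y : E) : ⟪refl v x, y⟫ = ⟪x, refl v y⟫ := by
  rw [LinearIsometryEquiv.inner_map_eq_flip, Submodule.reflection_symm]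

theorem inner_refl_of_norm_eq_one {v : E} (hv : ‖v‖ = 1) (x y : E) :
    ⟪x, refl v y⟫ = ⟪x, y⟫ - 2 * ⟪v, y⟫ * ⟪v, x⟫ := by
  rw [refl_apply_of_norm_eq_one hv, inner_sub_right, real_inner_smul_right, real_inner_comm v x]

theorem inner_isometry_left (w : E ≃ₗᵢ[ℝ] E) (x y : E) : ⟪w x, y⟫ = ⟪x, w⁻¹ y⟫ :=
  w.inner_map_eq_flip x y

theorem inv_apply_self (w : E ≃ₗᵢ[ℝ] E) (x : E) : w⁻¹ (w x) = x := w.symm_apply_apply x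

theorem apply_inv_self (w : E ≃ₗᵢ[ℝ] E) (x : E) : w (w⁻¹ x) = x := w.apply_symm_apply x

theorem refl_map (w : E ≃ₗᵢ[ℝ] E) (v : E) : refl (w v) = w * refl v * w⁻¹ := by
  ext x
  simp only [LinearIsometryEquiv.coe_mul, Function.comp_apply, refl_apply, map_sub, map_smul,
    apply_inv_self, inner_isometry_left, LinearIsometryEquiv.norm_map]

theorem eq_or_eq_neg_of_refl_eq {u v : E} (hu : ‖u‖ = 1) (hv : ‖v‖ = 1) (h : refl u = refl v) :
    u = v ∨ u = -v := by
  have hneg : u - (2 * ⟪v, u⟫) • v = -u := by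
    rw [← refl_apply_of_norm_eq_one hv, ← h, refl_self]
  have hsmul : u = ⟪v, u⟫ • v := by
    linear_combination (norm := module) (1 / 2 : ℝ) • hneg
  have habs : |⟪v, u⟫| = 1 := by
    simpa [norm_smul, hu, hv] using (congrArg norm hsmul).symm
  rcases (abs_eq zero_le_one).mp habs with h1 | h1
  · exact Or.inl (by rw [hsmul, h1, one_smul])
  · exact Or.inr (by rw [hsmul, h1, neg_one_smul])

/-- The group generated by the reflections in the vectors of a set. -/
def reflGroup (S : Set E) : Subgroup (E ≃ₗᵢ[ℝ] E) := Subgroup.closure ((fun v => refl v) '' S)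

theorem refl_mem_reflGroup {S : Set E} {v : E} (hv : v ∈ S) : refl v ∈ reflGroup S :=
  Subgroup.subset_closure ⟨v, hv, rfl⟩

theorem reflGroup_mono {S T : Set E} (h : S ⊆ T) : reflGroup S ≤ reflGroup T :=
  Subgroup.closure_mono (Set.image_mono h)

theorem map_conj_reflGroup (g : E ≃ₗᵢ[ℝ] E) (S : Set E) :
    (reflGroup S).map (MulAut.conj g).toMonoidHom = reflGroup (g '' S) := by
  simp only [reflGroup, MonoidHom.map_closure, Set.image_image, refl_map]
  rfl

theorem exists_list_of_mem_reflGroup {S : Set E} {w : E ≃ₗᵢ[ℝ] E} (hw : w ∈ reflGroup S) :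
    ∃ l : List E, (∀ v ∈ l, v ∈ S) ∧ (l.map fun v => refl v).prod = w := by
  induction hw using Subgroup.closure_induction_left with
  | one => exact ⟨[], by simp, rfl⟩
  | mul_left s hs w _ ih | inv_mul_cancel s hs w _ ih =>
    obtain ⟨v, hv, rfl⟩ := hs
    obtain ⟨l, hl, rfl⟩ := ih
    exact ⟨v :: l, by simpa [hv] using hl, by simp⟩

theorem apply_eq_of_mem_reflGroup {S : Set E} {x : E} (hS : ∀ v ∈ S, ⟪v, x⟫ = 0)
    {w : E ≃ₗᵢ[ℝ] E} (hw : w ∈ reflGroup S) : w x = x := by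
  induction hw using Subgroup.closure_induction_left with
  | one => rfl
  | mul_left s hs w _ ih | inv_mul_cancel s hs w _ ih =>
    obtain ⟨v, hv, rfl⟩ := hs
    simpa [ih, refl_eq_self_iff] using hS v hv

end Reflections

section Chambers

variable {E : Type*} [NormedAddCommGroup E] [InnerProductSpace ℝ E]

/-- The unit normals of the mirrors of `W`: a root system of `W` whose roots all have length one. -/
def unitRoots (W : Subgroup (E ≃ₗᵢ[ℝ] E)) : Set E := {v | ‖v‖ = 1 ∧ refl v ∈ W}

/-- The positive roots: the unit normals of the mirrors that point to the side of `x₀`. -/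
def posRoots (W : Subgroup (E ≃ₗᵢ[ℝ] E)) (x₀ : E) : Set E :=
  {v | v ∈ unitRoots W ∧ 0 < ⟪v, x₀⟫}

/-- The closed chamber of `W` that contains `x₀`, as the dual of the cone of positive roots. -/
def chamber (W : Subgroup (E ≃ₗᵢ[ℝ] E)) (x₀ : E) : PointedCone ℝ E :=
  PointedCone.dual (innerₗ E) (posRoots W x₀)

/-- The simple roots, characterized by the property of a simple system on which the exchange
condition rests: the positive roots whose reflections permute the other positive roots. -/
def simpleRoots (W : Subgroup (E ≃ₗᵢ[ℝ] E)) (x₀ : E) : Set E :=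
  {a | a ∈ posRoots W x₀ ∧ ∀ b ∈ posRoots W x₀, b ≠ a → refl a b ∈ posRoots W x₀}

variable {W : Subgroup (E ≃ₗᵢ[ℝ] E)} {x₀ : E}

theorem mem_chamber {y : E} : y ∈ chamber W x₀ ↔ ∀ v ∈ posRoots W x₀, 0 ≤ ⟪v, y⟫ := Iff.rfl

theorem isClosed_chamber : IsClosed (chamber W x₀ : Set E) := by
  have h : (chamber W x₀ : Set E) = ⋂ v ∈ posRoots W x₀, {y | 0 ≤ ⟪v, y⟫} := by
    ext y; simp [mem_chamber]
  rw [h]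
  exact isClosed_biInter fun v _ => isClosed_le continuous_const (by fun_prop)

theorem ne_zero_of_mem_unitRoots {v : E} (hv : v ∈ unitRoots W) : v ≠ 0 :=
  norm_ne_zero_iff.mp (hv.1.trans_ne one_ne_zero)

theorem smul_mem_unitRoots {v : E} (hv : v ≠ 0) (hvW : refl v ∈ W) : ‖v‖⁻¹ • v ∈ unitRoots W :=
  ⟨norm_smul_inv_norm hv, by rwa [refl_smul (inv_ne_zero (norm_ne_zero_iff.mpr hv))]⟩

theorem map_mem_unitRoots {w : E ≃ₗᵢ[ℝ] E} (hw : w ∈ W) {v : E} (hv : v ∈ unitRoots W) :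
    w v ∈ unitRoots W := by
  refine ⟨by simpa using hv.1, ?_⟩
  rw [refl_map]
  exact W.mul_mem (W.mul_mem hw hv.2) (W.inv_mem hw)

theorem neg_mem_unitRoots {v : E} (hv : v ∈ unitRoots W) : -v ∈ unitRoots W :=
  ⟨by simpa using hv.1, by rw [refl_neg]; exact hv.2⟩

theorem mem_mirrorCompl_iff {x : E} : x ∈ mirrorCompl W ↔ ∀ v ∈ unitRoots W, ⟪v, x⟫ ≠ 0 := by
  refine ⟨fun hx v hv => hx v (ne_zero_of_mem_unitRoots hv) hv.2, fun hx v hv hvW h => ?_⟩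
  exact hx _ (smul_mem_unitRoots hv hvW) (by rw [real_inner_smul_left, h, mul_zero])

theorem map_mem_mirrorCompl {w : E ≃ₗᵢ[ℝ] E} (hw : w ∈ W) {x : E} (hx : x ∈ mirrorCompl W) :
    w x ∈ mirrorCompl W := by
  rw [mem_mirrorCompl_iff] at hx ⊢
  intro v hv h
  rw [real_inner_comm, inner_isometry_left, real_inner_comm] at h
  exact hx _ (map_mem_unitRoots (W.inv_mem hw) hv) h

theorem finite_unitRoots [Finite W] : (unitRoots W).Finite := by
  have hW : (W : Set (E ≃ₗᵢ[ℝ] E)).Finite := Set.toFinite _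
  refine Set.Finite.of_finite_fibers (fun v => refl v)
    (hW.subset (Set.image_subset_iff.mpr fun v hv => hv.2)) fun s _ => ?_
  rcases (unitRoots W ∩ (fun v => refl v) ⁻¹' {s}).eq_empty_or_nonempty with h | ⟨u, hu, rfl⟩
  · exact h ▸ Set.finite_empty
  · exact (Set.toFinite {u, -u}).subset fun v hv => eq_or_eq_neg_of_refl_eq hv.1.1 hu.1 hv.2

theorem finite_posRoots [Finite W] : (posRoots W x₀).Finite :=
  finite_unitRoots.subset fun _ hv => hv.1

theorem mem_posRoots_or_neg_mem (hx : x₀ ∈ mirrorCompl W) {v : E} (hv : v ∈ unitRoots W) :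
    v ∈ posRoots W x₀ ∨ -v ∈ posRoots W x₀ := by
  rcases (mem_mirrorCompl_iff.mp hx v hv).lt_or_gt with h | h
  · exact Or.inr ⟨neg_mem_unitRoots hv, by rwa [inner_neg_left, neg_pos]⟩
  · exact Or.inl ⟨hv, h⟩

theorem mem_chamber_self : x₀ ∈ chamber W x₀ := fun _ hv => hv.2.le

theorem posRoots_eq_of_mem_chamber (hx₀ : x₀ ∈ mirrorCompl W) {x : E} (hx : x ∈ mirrorCompl W)
    (hxC : x ∈ chamber W x₀) : posRoots W x = posRoots W x₀ := by
  ext v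
  refine ⟨fun ⟨hv, hvx⟩ => (mem_posRoots_or_neg_mem hx₀ hv).resolve_right fun h => ?_,
    fun hv => ⟨hv.1, (hxC hv).lt_of_ne' (mem_mirrorCompl_iff.mp hx v hv.1)⟩⟩
  have := mem_chamber.mp hxC _ h
  rw [inner_neg_left] at this
  linarith

theorem mem_chamber_iff_forall_mul_nonneg (hx : x₀ ∈ mirrorCompl W) {y : E} :
    y ∈ chamber W x₀ ↔ ∀ v : E, refl v ∈ W → 0 ≤ ⟪v, x₀⟫ * ⟪v, y⟫ := by
  refine ⟨fun hy v hvW => ?_, fun hy v hv => nonneg_of_mul_nonneg_right (hy v hv.1.2) hv.2⟩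
  rcases eq_or_ne v 0 with rfl | hv
  · simp
  have hn : 0 < ‖v‖⁻¹ * ‖v‖⁻¹ := by positivity
  refine nonneg_of_mul_nonneg_right ?_ hn
  have hscale : ‖v‖⁻¹ * ‖v‖⁻¹ * (⟪v, x₀⟫ * ⟪v, y⟫) = ⟪‖v‖⁻¹ • v, x₀⟫ * ⟪‖v‖⁻¹ • v, y⟫ := by
    simp only [real_inner_smul_left]; ring
  rw [hscale]
  rcases mem_posRoots_or_neg_mem hx (smul_mem_unitRoots hv hvW) with h | h
  · exact mul_nonneg h.2.le (hy h)
  · rw [← neg_mul_neg, ← inner_neg_left, ← inner_neg_left]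
    exact mul_nonneg h.2.le (hy h)

theorem IsFundamentalCone.exists_eq_chamber {C : PointedCone ℝ E} (hC : IsFundamentalCone W C) :
    ∃ x₀ ∈ mirrorCompl W, C = chamber W x₀ := by
  obtain ⟨x₀, hx, hCx⟩ := hC
  exact ⟨x₀, hx, SetLike.ext fun y =>
    (hCx y).trans (mem_chamber_iff_forall_mul_nonneg hx).symm⟩

end Chambers

section SimpleRoots

variable {E : Type*} [NormedAddCommGroup E] [InnerProductSpace ℝ E]
  {W : Subgroup (E ≃ₗᵢ[ℝ] E)} {x₀ : E}

theorem mem_simpleRoots_of_forall_inner_le (hx : x₀ ∈ mirrorCompl W) {a z : E}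
    (hz : z ∈ chamber W x₀) (ha : a ∈ posRoots W x₀) (haz : ⟪a, z⟫ = 0)
    (hmin : ∀ c ∈ posRoots W x₀, ⟪c, z⟫ = 0 → ⟪a, x₀⟫ ≤ ⟪c, x₀⟫) : a ∈ simpleRoots W x₀ := by
  refine ⟨ha, fun c hc hca => ?_⟩
  by_contra hneg
  have hd : -refl a c ∈ posRoots W x₀ :=
    (mem_posRoots_or_neg_mem hx (map_mem_unitRoots ha.1.2 hc.1)).resolve_left hneg
  have hinner : ∀ y, ⟪-refl a c, y⟫ = 2 * ⟪a, c⟫ * ⟪a, y⟫ - ⟪c, y⟫ := fun y => by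
    rw [inner_neg_left, refl_apply_of_norm_eq_one ha.1.1, inner_sub_left, real_inner_smul_left,
      neg_sub]
  have hcz : ⟪c, z⟫ = 0 := by
    have := mem_chamber.mp hz _ hd
    rw [hinner, haz, mul_zero, zero_sub] at this
    linarith [mem_chamber.mp hz c hc]
  have hac : ⟪a, c⟫ < 1 := (inner_lt_one_iff_real_of_norm_eq_one ha.1.1 hc.1.1).mpr hca.symm
  have hcx := hmin c hc hcz
  have hdx := hmin _ hd (by rw [hinner, haz, hcz, mul_zero, sub_zero])
  rw [hinner] at hdx
  nlinarith [mul_pos (sub_pos.mpr hac) ha.2]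

-- `z` is the point where the ray from `x₀` in direction `-b` hits the first mirror.
theorem exists_mem_chamber_forall_inner_pos [Finite W] {b : E} (hb : b ∈ posRoots W x₀) :
    ∃ z ∈ chamber W x₀, (∃ a ∈ posRoots W x₀, ⟪a, z⟫ = 0) ∧
      ∀ c ∈ posRoots W x₀, ⟪c, z⟫ = 0 → 0 < ⟪c, b⟫ := by
  have hfin : {a | a ∈ posRoots W x₀ ∧ 0 < ⟪a, b⟫}.Finite := finite_posRoots.subset fun _ h => h.1
  have hbb : 0 < ⟪b, b⟫ := real_inner_self_pos.mpr (ne_zero_of_mem_unitRoots hb.1)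
  obtain ⟨a, ⟨ha, hab⟩, hmin⟩ :=
    Set.exists_min_image _ (fun a => ⟪a, x₀⟫ / ⟪a, b⟫) hfin ⟨b, hb, hbb⟩
  set t := ⟪a, x₀⟫ / ⟪a, b⟫
  have ht : 0 < t := div_pos ha.2 hab
  have hz : ∀ c, ⟪c, x₀ - t • b⟫ = ⟪c, x₀⟫ - t * ⟪c, b⟫ := fun c => by
    rw [inner_sub_right, real_inner_smul_right]
  refine ⟨x₀ - t • b, fun c hc => ?_, ⟨a, ha, ?_⟩, fun c hc hcz => ?_⟩
  · rw [innerₗ_apply_apply, hz, sub_nonneg]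
    rcases le_or_gt ⟪c, b⟫ 0 with h | h
    · exact (mul_nonpos_of_nonneg_of_nonpos ht.le h).trans hc.2.le
    · exact (le_div_iff₀ h).mp (hmin c ⟨hc, h⟩)
  · rw [hz, div_mul_cancel₀ _ hab.ne', sub_self]
  · rw [hz, sub_eq_zero] at hcz
    exact pos_of_mul_pos_right (hcz ▸ hc.2) ht.le

theorem exists_simpleRoot_inner_pos [Finite W] (hx : x₀ ∈ mirrorCompl W) {b : E}
    (hb : b ∈ posRoots W x₀) : ∃ a ∈ simpleRoots W x₀, 0 < ⟪a, b⟫ := by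
  obtain ⟨z, hz, ⟨a₀, ha₀, ha₀z⟩, hacute⟩ := exists_mem_chamber_forall_inner_pos hb
  have hfin : {a | a ∈ posRoots W x₀ ∧ ⟪a, z⟫ = 0}.Finite := finite_posRoots.subset fun _ h => h.1
  obtain ⟨a, ⟨ha, haz⟩, hmin⟩ := Set.exists_min_image _ (fun a => ⟪a, x₀⟫) hfin ⟨a₀, ha₀, ha₀z⟩
  exact ⟨a, mem_simpleRoots_of_forall_inner_le hx hz ha haz fun c hc hcz => hmin c ⟨hc, hcz⟩,
    hacute a ha haz⟩

-- Reflecting in a simple root that makes an acute angle with `b` lowers the height `⟪b, x₀⟫`, so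
-- the lowest positive root in the orbit of `v` is simple.
theorem refl_mem_reflGroup_simpleRoots_of_mem_posRoots [Finite W] (hx : x₀ ∈ mirrorCompl W)
    {v : E} (hv : v ∈ posRoots W x₀) : refl v ∈ reflGroup (simpleRoots W x₀) := by
  have hfin : {b | b ∈ posRoots W x₀ ∧ ∃ g ∈ reflGroup (simpleRoots W x₀), g v = b}.Finite :=
    finite_posRoots.subset fun _ hb => hb.1
  obtain ⟨b, ⟨hb, g, hg, hgv⟩, hmin⟩ :=
    Set.exists_min_image _ (fun b => ⟪b, x₀⟫) hfin ⟨v, hv, 1, one_mem _, rfl⟩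
  obtain ⟨a, ha, hab⟩ := exists_simpleRoot_inner_pos hx hb
  have hba : b = a := by
    by_contra hne
    have hle : ⟪b, x₀⟫ ≤ ⟪refl a b, x₀⟫ := hmin _
      ⟨ha.2 b hb hne, refl a * g, mul_mem (refl_mem_reflGroup ha) hg, by rw [← hgv]; rfl⟩
    rw [real_inner_comm x₀, real_inner_comm x₀, inner_refl_of_norm_eq_one ha.1.1.1] at hle
    linarith [mul_pos hab ha.1.2]
  have hv' : v = g⁻¹ a := by rw [← hba, ← hgv, inv_apply_self]
  rw [hv', refl_map, inv_inv]
  exact mul_mem (mul_mem (inv_mem hg) (refl_mem_reflGroup ha)) hg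

theorem refl_mem_reflGroup_simpleRoots [Finite W] (hx : x₀ ∈ mirrorCompl W) {v : E} (hv : v ≠ 0)
    (hvW : refl v ∈ W) : refl v ∈ reflGroup (simpleRoots W x₀) := by
  rw [← refl_smul (inv_ne_zero (norm_ne_zero_iff.mpr hv))]
  rcases mem_posRoots_or_neg_mem hx (smul_mem_unitRoots hv hvW) with h | h
  · exact refl_mem_reflGroup_simpleRoots_of_mem_posRoots hx h
  · rw [← refl_neg]
    exact refl_mem_reflGroup_simpleRoots_of_mem_posRoots hx h

theorem IsFiniteReflectionGroup.le_reflGroup_simpleRoots (hW : IsFiniteReflectionGroup W)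
    (hx : x₀ ∈ mirrorCompl W) : W ≤ reflGroup (simpleRoots W x₀) := by
  have := hW.finite
  obtain ⟨S, hS, hWS⟩ := hW.generated
  nth_rw 1 [hWS]
  rw [Subgroup.closure_le]
  intro s hs
  obtain ⟨v, hv, rfl⟩ := hS s hs
  exact refl_mem_reflGroup_simpleRoots hx hv (hWS ▸ Subgroup.subset_closure hs)

theorem exists_list_prod_eq_mul_refl {a : E} (ha : a ∈ simpleRoots W x₀) (l : List E)
    (hl : ∀ v ∈ l, v ∈ simpleRoots W x₀)
    (hneg : (l.map fun v => refl v).prod a ∉ posRoots W x₀) :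
    ∃ m : List E, (∀ v ∈ m, v ∈ simpleRoots W x₀) ∧ m.length + 1 = l.length ∧
      (m.map fun v => refl v).prod = (l.map fun v => refl v).prod * refl a := by
  induction l with
  | nil => exact absurd ha.1 hneg
  | cons b l ih =>
    obtain ⟨hb, hl⟩ := List.forall_mem_cons.mp hl
    rw [List.map_cons, List.prod_cons] at hneg ⊢
    by_cases hpos : (l.map fun v => refl v).prod a ∈ posRoots W x₀
    · have hlab : (l.map fun v => refl v).prod a = b := by
        by_contra hne
        exact hneg (hb.2 _ hpos hne)
      refine ⟨l, hl, rfl, ?_⟩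
      rw [← hlab, refl_map, inv_mul_cancel_right, mul_assoc, Submodule.reflection_mul_reflection,
        mul_one]
    · obtain ⟨m, hm, hlen, hprod⟩ := ih hl hpos
      exact ⟨b :: m, List.forall_mem_cons.mpr ⟨hb, hm⟩, by simp [hlen],
        by rw [List.map_cons, List.prod_cons, hprod, mul_assoc]⟩

theorem list_prod_mem_reflGroup_of_mem_chamber {x : E} (hxC : x ∈ chamber W x₀) (l : List E)
    (hl : ∀ v ∈ l, v ∈ simpleRoots W x₀) (hlx : (l.map fun v => refl v).prod x ∈ chamber W x₀) :
    (l.map fun v => refl v).prod ∈ reflGroup {a | a ∈ simpleRoots W x₀ ∧ ⟪a, x⟫ = 0} := by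
  induction hn : l.length using Nat.strong_induction_on generalizing l with
  | _ n ih =>
    rcases l.eq_nil_or_concat with rfl | ⟨m, a, rfl⟩
    · exact one_mem _
    obtain ⟨hm, ha⟩ : (∀ v ∈ m, v ∈ simpleRoots W x₀) ∧ a ∈ simpleRoots W x₀ := by
      simpa [or_imp, forall_and] using hl
    simp only [List.concat_eq_append, List.map_append, List.map_cons, List.map_nil,
      List.prod_append, List.prod_singleton, List.length_append, List.length_singleton]
      at hlx hn ⊢
    by_cases hpos : (m.map fun v => refl v).prod a ∈ posRoots W x₀
    · have hax : ⟪a, x⟫ = 0 := by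
        have h : 0 ≤ ⟪(m.map fun v => refl v).prod a, (m.map fun v => refl v).prod (refl a x)⟫ :=
          hlx hpos
        rw [LinearIsometryEquiv.inner_map_map, ← inner_refl_left, refl_self, inner_neg_left] at h
        linarith [mem_chamber.mp hxC a ha.1]
      have hmx : (m.map fun v => refl v).prod x ∈ chamber W x₀ := by
        simpa [(refl_eq_self_iff a x).mpr hax] using hlx
      exact mul_mem (ih m.length (by omega) m hm hmx rfl)
        (refl_mem_reflGroup (S := {a | a ∈ simpleRoots W x₀ ∧ ⟪a, x⟫ = 0}) ⟨ha, hax⟩)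
    · obtain ⟨m', hm', hlen, hprod⟩ := exists_list_prod_eq_mul_refl ha m hm hpos
      rw [← hprod] at hlx ⊢
      exact ih m'.length (by omega) m' hm' hlx rfl

theorem mem_reflGroup_of_mem_chamber (hW : IsFiniteReflectionGroup W) (hx : x₀ ∈ mirrorCompl W)
    {w : E ≃ₗᵢ[ℝ] E} (hw : w ∈ W) {x : E} (hxC : x ∈ chamber W x₀) (hwx : w x ∈ chamber W x₀) :
    w ∈ reflGroup {a | a ∈ unitRoots W ∧ ⟪a, x⟫ = 0} := by
  obtain ⟨l, hl, rfl⟩ := exists_list_of_mem_reflGroup (hW.le_reflGroup_simpleRoots hx hw)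
  refine reflGroup_mono ?_ (list_prod_mem_reflGroup_of_mem_chamber hxC l hl hwx)
  exact fun a ha => ⟨ha.1.1.1, ha.2⟩

theorem eq_of_mem_chamber (hW : IsFiniteReflectionGroup W) (hx : x₀ ∈ mirrorCompl W)
    {w : E ≃ₗᵢ[ℝ] E} (hw : w ∈ W) {x : E} (hxC : x ∈ chamber W x₀) (hwx : w x ∈ chamber W x₀) :
    w x = x :=
  apply_eq_of_mem_reflGroup (fun _ hv => hv.2) (mem_reflGroup_of_mem_chamber hW hx hw hxC hwx)

end SimpleRoots

section Orbits

variable {E : Type*} [NormedAddCommGroup E] [InnerProductSpace ℝ E]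
  {W : Subgroup (E ≃ₗᵢ[ℝ] E)} {x₀ : E}

-- `w y` maximizes `⟪x, ·⟫` on the orbit of `y`, with ties broken by `⟪x₀, ·⟫`: a reflection
-- in a mirror separating `w y` from `x₀` would increase this pair.
theorem exists_map_mem_chamber_forall_inner_le [Finite W] {x : E} (hxC : x ∈ chamber W x₀)
    (y : E) : ∃ w ∈ W, w y ∈ chamber W x₀ ∧ ∀ w' ∈ W, ⟪x, w' y⟫ ≤ ⟪x, w y⟫ := by
  obtain ⟨⟨w, hw⟩, hmax⟩ := Finite.exists_max
    fun w : W => toLex (⟪x, (w : E ≃ₗᵢ[ℝ] E) y⟫, ⟪x₀, (w : E ≃ₗᵢ[ℝ] E) y⟫)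
  have hle : ∀ w' ∈ W, ⟪x, w' y⟫ < ⟪x, w y⟫ ∨ ⟪x, w' y⟫ = ⟪x, w y⟫ ∧ ⟪x₀, w' y⟫ ≤ ⟪x₀, w y⟫ :=
    fun w' hw' => Prod.Lex.le_iff.mp (hmax ⟨w', hw'⟩)
  refine ⟨w, hw, fun v hv => ?_, fun w' hw' => (hle w' hw').elim le_of_lt fun h => h.1.le⟩
  by_contra! hvw : ⟪v, w y⟫ < 0
  have h := hle (refl v * w) (W.mul_mem hv.1.2 hw)
  simp only [LinearIsometryEquiv.coe_mul, Function.comp_apply,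
    inner_refl_of_norm_eq_one hv.1.1] at h
  rcases h with h | ⟨-, h⟩
  · nlinarith [mul_nonpos_of_nonpos_of_nonneg hvw.le (mem_chamber.mp hxC v hv)]
  · nlinarith [mul_neg_of_neg_of_pos hvw hv.2]

theorem exists_map_mem_chamber [Finite W] (x₀ y : E) : ∃ w ∈ W, w y ∈ chamber W x₀ :=
  (exists_map_mem_chamber_forall_inner_le mem_chamber_self y).imp fun _ h => ⟨h.1, h.2.1⟩

theorem inner_map_le (hW : IsFiniteReflectionGroup W) (hx : x₀ ∈ mirrorCompl W) {x y : E}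
    (hxC : x ∈ chamber W x₀) (hyC : y ∈ chamber W x₀) {w : E ≃ₗᵢ[ℝ] E} (hw : w ∈ W) :
    ⟪x, w y⟫ ≤ ⟪x, y⟫ := by
  have := hW.finite
  obtain ⟨g, hg, hgy, hmax⟩ := exists_map_mem_chamber_forall_inner_le hxC y
  exact (hmax w hw).trans_eq (by rw [eq_of_mem_chamber hW hx hg hyC hgy])

theorem eq_of_inner_map_eq (hW : IsFiniteReflectionGroup W) (hx₀ : x₀ ∈ mirrorCompl W) {x y : E}
    (hx : x ∈ mirrorCompl W) (hxC : x ∈ chamber W x₀) (hyC : y ∈ chamber W x₀)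
    {w : E ≃ₗᵢ[ℝ] E} (hw : w ∈ W) (h : ⟪x, w y⟫ = ⟪x, y⟫) : w y = y := by
  refine eq_of_mem_chamber hW hx₀ hw hyC fun v hv => ?_
  have hvx : 0 < ⟪v, x⟫ := (posRoots_eq_of_mem_chamber hx₀ hx hxC ▸ hv).2
  have hle := inner_map_le hW hx₀ hxC hyC (W.mul_mem hv.1.2 hw)
  rw [LinearIsometryEquiv.coe_mul, Function.comp_apply, inner_refl_of_norm_eq_one hv.1.1, h] at hle
  by_contra! hvw : ⟪v, w y⟫ < 0
  nlinarith [mul_neg_of_neg_of_pos hvw hvx]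

theorem mem_reflGroup_of_apply_eq (hW : IsFiniteReflectionGroup W) (hx : x₀ ∈ mirrorCompl W)
    {w : E ≃ₗᵢ[ℝ] E} (hw : w ∈ W) {x : E} (hwx : w x = x) :
    w ∈ reflGroup {a | a ∈ unitRoots W ∧ ⟪a, x⟫ = 0} := by
  have := hW.finite
  obtain ⟨g, hg, hgx⟩ := exists_map_mem_chamber (W := W) x₀ x
  have hfix : (g * w * g⁻¹) (g x) = g x := by
    simp only [LinearIsometryEquiv.coe_mul, Function.comp_apply, inv_apply_self, hwx]
  have hconj := mem_reflGroup_of_mem_chamber hW hx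
    (W.mul_mem (W.mul_mem hg hw) (W.inv_mem hg)) hgx (by rwa [hfix])
  have hw' : w ∈ reflGroup (⇑g⁻¹ '' {a | a ∈ unitRoots W ∧ ⟪a, g x⟫ = 0}) := by
    rw [← map_conj_reflGroup]
    exact ⟨_, hconj, by simp [mul_assoc]⟩
  refine reflGroup_mono (Set.image_subset_iff.mpr fun a ha => ?_) hw'
  exact ⟨map_mem_unitRoots (W.inv_mem hg) ha.1, by rw [inner_isometry_left, inv_inv, ha.2]⟩

theorem eq_one_of_apply_eq (hW : IsFiniteReflectionGroup W) {w : E ≃ₗᵢ[ℝ] E} (hw : w ∈ W) {x : E}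
    (hx : x ∈ mirrorCompl W) (hwx : w x = x) : w = 1 := by
  have hempty : {a | a ∈ unitRoots W ∧ ⟪a, x⟫ = 0} = ∅ :=
    Set.eq_empty_of_forall_notMem fun a ha => mem_mirrorCompl_iff.mp hx a ha.1 ha.2
  have h := mem_reflGroup_of_apply_eq hW hx hw hwx
  simpa [hempty, reflGroup] using h

theorem eq_of_map_mem_chamber (hW : IsFiniteReflectionGroup W) (hx : x₀ ∈ mirrorCompl W)
    {g h : E ≃ₗᵢ[ℝ] E} (hg : g ∈ W) (hh : h ∈ W) {y : E} (hy : y ∈ mirrorCompl W)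
    (hgy : g y ∈ chamber W x₀) (hhy : h y ∈ chamber W x₀) : g = h := by
  have hgh : (g * h⁻¹) (h y) = g y := by
    rw [LinearIsometryEquiv.coe_mul, Function.comp_apply, inv_apply_self]
  have hmem : g * h⁻¹ ∈ W := W.mul_mem hg (W.inv_mem hh)
  exact mul_inv_eq_one.mp (eq_one_of_apply_eq hW hmem (map_mem_mirrorCompl hh hy)
    (eq_of_mem_chamber hW hx hmem hhy (by rwa [hgh])))

end Orbits

section BallFraction

variable {E : Type*} [NormedAddCommGroup E] [InnerProductSpace ℝ E] [FiniteDimensional ℝ E]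
  [MeasurableSpace E] [BorelSpace E]

theorem ballFraction_eq_zero {S : Set E} (h : ∀ᵐ x : E, x ∉ S) : ballFraction S = 0 := by
  have hS : volume S = 0 := measure_eq_zero_iff_ae_notMem.mpr h
  simp [ballFraction, measure_mono_null Set.inter_subset_left hS]

theorem sum_ballFraction_of_ae_card_eq {ι : Type*} [Fintype ι] {S : ι → Set E}
    (hS : ∀ i, MeasurableSet (S i)) {c : ℕ} (h : ∀ᵐ x : E, Nat.card {i // x ∈ S i} = c) :
    ∑ i, ballFraction (S i) = c := by
  classical
  let B : Set E := Metric.closedBall 0 1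
  have hBfin : volume B ≠ ⊤ := measure_closedBall_lt_top.ne
  have hBpos : volume B ≠ 0 := (Metric.measure_closedBall_pos volume 0 one_pos).ne'
  have hsum : ∑ i, volume (S i ∩ B) = c * volume B := by
    calc ∑ i, volume (S i ∩ B)
        = ∑ i, ∫⁻ x in B, (S i).indicator 1 x := by
          simp_rw [lintegral_indicator_one (hS _), Measure.restrict_apply (hS _)]
      _ = ∫⁻ x in B, ∑ i, (S i).indicator 1 x :=
          (lintegral_finsetSum _ fun i _ => measurable_one.indicator (hS i)).symm
      _ = ∫⁻ _ in B, (c : ENNReal) := by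
          refine lintegral_congr_ae (ae_restrict_of_ae ?_)
          filter_upwards [h] with x hx
          rw [← hx]
          simp [Set.indicator_apply, Nat.card_eq_fintype_card, Fintype.card_subtype]
      _ = c * volume B := setLIntegral_const _ _
  have hreal := congrArg ENNReal.toReal hsum
  rw [ENNReal.toReal_sum fun i _ => measure_ne_top_of_subset Set.inter_subset_right hBfin,
    ENNReal.toReal_mul, ENNReal.toReal_natCast] at hreal
  simp only [ballFraction]
  rw [← Finset.sum_div, hreal, mul_div_cancel_right₀]
  exact ENNReal.toReal_ne_zero.mpr ⟨hBpos, hBfin⟩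

theorem ballFraction_preimage {F : Type*} [NormedAddCommGroup F] [InnerProductSpace ℝ F]
    [FiniteDimensional ℝ F] [MeasurableSpace F] [BorelSpace F] (f : E ≃ₗᵢ[ℝ] F) (S : Set F) :
    ballFraction (f ⁻¹' S) = ballFraction S := by
  have hf : MeasurePreserving f.toMeasurableEquiv volume volume := f.measurePreserving
  have hball : f ⁻¹' Metric.closedBall 0 1 = Metric.closedBall 0 1 := by
    simp
  rw [ballFraction, ballFraction, ← hball, ← Set.preimage_inter]
  congr 2 <;> exact hf.measure_preimage_equiv _

theorem ae_notMem_submodule {p : Submodule ℝ E} (hp : p ≠ ⊤) : ∀ᵐ x : E, x ∉ p :=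
  measure_eq_zero_iff_ae_notMem.mp (Measure.addHaar_submodule volume p hp)

end BallFraction

section DualChamber

-- The fixed points of the contractions `t • f`, `t < 1`, accumulate at a fixed point of `f`.
theorem exists_fixedPoint_of_lipschitzWith_one {E : Type*} [NormedAddCommGroup E]
    [NormedSpace ℝ E] [ProperSpace E] {f : E → E} (hf : LipschitzWith 1 f) {R : ℝ}
    (hR : ∀ t : ℝ, 0 ≤ t → t < 1 → ∀ x, t • f x = x → ‖x‖ ≤ R) : ∃ x, f x = x := by
  let t : ℕ → ℝ := fun n => n / (n + 1)
  have ht0 : ∀ n, 0 ≤ t n := fun n => by positivity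
  have ht1 : ∀ n, t n < 1 := fun n => (div_lt_one (by positivity)).mpr (lt_add_one _)
  have hcontr : ∀ n, ContractingWith ‖t n‖₊ fun x => t n • f x := fun n =>
    ⟨by rw [← NNReal.coe_lt_one, coe_nnnorm, Real.norm_of_nonneg (ht0 n)]; exact ht1 n,
      mul_one ‖t n‖₊ ▸ (lipschitzWith_smul (t n)).comp hf⟩
  choose x hx using fun n => (⟨_, (hcontr n).fixedPoint_isFixedPt⟩ : ∃ x, t n • f x = x)
  obtain ⟨z, -, φ, hφ, hz⟩ := (isCompact_closedBall (0 : E) R).tendsto_subseq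
    fun n => mem_closedBall_zero_iff.mpr (hR (t n) (ht0 n) (ht1 n) (x n) (hx n))
  have ht : Filter.Tendsto (t ∘ φ) Filter.atTop (nhds 1) :=
    (tendsto_natCast_div_add_atTop (1 : ℝ)).comp hφ.tendsto_atTop
  have hlim := ht.smul ((hf.continuous.tendsto z).comp hz)
  refine ⟨z, tendsto_nhds_unique ?_ hz⟩
  rw [one_smul] at hlim
  exact hlim.congr fun n => hx (φ n)

variable {E : Type*} [NormedAddCommGroup E] [InnerProductSpace ℝ E]
  {W : Subgroup (E ≃ₗᵢ[ℝ] E)} {x₀ : E}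

theorem dist_map_map_le (hW : IsFiniteReflectionGroup W) (hx : x₀ ∈ mirrorCompl W)
    {g h : E ≃ₗᵢ[ℝ] E} (hg : g ∈ W) (hh : h ∈ W) {x y : E} (hgx : g x ∈ chamber W x₀)
    (hhy : h y ∈ chamber W x₀) : dist (g x) (h y) ≤ dist x y := by
  have hinner : ⟪x, y⟫ ≤ ⟪g x, h y⟫ := by
    have h1 := inner_map_le hW hx hgx hhy (W.mul_mem hg (W.inv_mem hh))
    rwa [LinearIsometryEquiv.coe_mul, Function.comp_apply, inv_apply_self, g.inner_map_map] at h1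
  rw [dist_eq_norm, dist_eq_norm, ← sq_le_sq₀ (norm_nonneg _) (norm_nonneg _), norm_sub_sq_real,
    norm_sub_sq_real, g.norm_map, h.norm_map]
  linarith

theorem mem_fixedSpace {w : E ≃ₗᵢ[ℝ] E} {x : E} : x ∈ fixedSpace w ↔ w x = x := by
  rw [fixedSpace, LinearMap.mem_ker, LinearMap.sub_apply, sub_eq_zero, eq_comm]
  rfl

theorem mem_chamber_apply_iff {g : E ≃ₗᵢ[ℝ] E} (hg : g ∈ W) {y : E} :
    y ∈ chamber W (g x₀) ↔ g⁻¹ y ∈ chamber W x₀ := by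
  refine ⟨fun hy v hv => ?_, fun hy v hv => ?_⟩
  · rw [innerₗ_apply_apply, real_inner_comm, inner_isometry_left, inv_inv, real_inner_comm]
    exact hy ⟨map_mem_unitRoots hg hv.1, by rw [g.inner_map_map]; exact hv.2⟩
  · rw [innerₗ_apply_apply, ← (g⁻¹).inner_map_map]
    refine hy ⟨map_mem_unitRoots (W.inv_mem hg) hv.1, ?_⟩
    rw [inner_isometry_left, inv_inv]
    exact hv.2

theorem existsUnique_mem_chamber_apply (hW : IsFiniteReflectionGroup W)
    (hx : x₀ ∈ mirrorCompl W) {y : E} (hy : y ∈ mirrorCompl W) :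
    ∃! g : W, y ∈ chamber W ((g : E ≃ₗᵢ[ℝ] E) x₀) := by
  have := hW.finite
  obtain ⟨g, hg, hgy⟩ := exists_map_mem_chamber (W := W) x₀ y
  refine ⟨⟨g⁻¹, W.inv_mem hg⟩, ?_, fun h hh => ?_⟩
  · exact (mem_chamber_apply_iff (W.inv_mem hg)).mpr (by rwa [inv_inv])
  · have hhy := (mem_chamber_apply_iff h.2).mp hh
    have hinv := eq_of_map_mem_chamber hW hx (W.inv_mem h.2) hg hy hhy hgy
    exact Subtype.ext (inv_eq_iff_eq_inv.mp hinv)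

theorem eq_of_sub_apply_eq (hW : IsFiniteReflectionGroup W) (hx₀ : x₀ ∈ mirrorCompl W)
    {x y : E} (hx : x ∈ mirrorCompl W) (hxC : x ∈ chamber W x₀) (hyC : y ∈ chamber W x₀)
    {w w' : E ≃ₗᵢ[ℝ] E} (hw : w ∈ W) (hw' : w' ∈ W) (hfix : fixedSpace w = ⊥)
    (h : x - w x = y - w' y) : w = w' := by
  have hsub : w x - w' y = x - y := by
    rw [sub_eq_sub_iff_add_eq_add] at h ⊢
    rw [add_comm, ← h]
  have hinner : ⟪x, w⁻¹ (w' y)⟫ = ⟪x, y⟫ := by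
    have := congrArg (‖·‖ ^ 2) hsub
    simp only [norm_sub_sq_real, LinearIsometryEquiv.norm_map] at this
    rw [← inner_isometry_left]
    linarith
  have hww : w⁻¹ * w' ∈ W := W.mul_mem (W.inv_mem hw) hw'
  have hwy : w⁻¹ (w' y) = y := eq_of_inner_map_eq hW hx₀ hx hxC hyC hww hinner
  have hxy : x = y := by
    rw [← apply_inv_self w (w' y), hwy, ← map_sub] at hsub
    exact sub_eq_zero.mp ((Submodule.eq_bot_iff _).mp hfix _ (mem_fixedSpace.mpr hsub))
  subst hxy
  exact inv_mul_eq_one.mp (eq_one_of_apply_eq hW hww hx hwy)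

/-- The points that are not of the form `x - w x` with `w ∈ W` singular or `x` on a mirror. -/
def IsGenericPoint (W : Subgroup (E ≃ₗᵢ[ℝ] E)) (v : E) : Prop :=
  ∀ w ∈ W, ∀ x, x - w x = v → fixedSpace w = ⊥ ∧ x ∈ mirrorCompl W

variable [FiniteDimensional ℝ E]

theorem mem_dualCone {C : PointedCone ℝ E} {v : E} : v ∈ dualCone C ↔ ∀ x ∈ C, 0 ≤ ⟪x, v⟫ :=
  Iff.rfl

theorem isClosed_dualCone (C : PointedCone ℝ E) : IsClosed (dualCone C : Set E) :=
  (ProperCone.innerDual (C : Set E)).isClosed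

theorem exists_pos_forall_mul_norm_le_inner {C : PointedCone ℝ E} {v : E}
    (hv : v ∈ interior (dualCone C : Set E)) : ∃ ε > 0, ∀ x ∈ C, ε * ‖x‖ ≤ ⟪x, v⟫ := by
  obtain ⟨ε, hε, hball⟩ :=
    Metric.nhds_basis_closedBall.mem_iff.mp (mem_interior_iff_mem_nhds.mp hv)
  refine ⟨ε, hε, fun x hxC => ?_⟩
  rcases eq_or_ne x 0 with rfl | hne
  · simp
  have hn : 0 < ‖x‖ := norm_pos_iff.mpr hne
  have hmem : v - (ε / ‖x‖) • x ∈ dualCone C := hball <| by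
    rw [Metric.mem_closedBall, dist_eq_norm, sub_sub_cancel_left, norm_neg, norm_smul,
      Real.norm_of_nonneg (by positivity), div_mul_cancel₀ _ hn.ne']
  have h := mem_dualCone.mp hmem x hxC
  rw [inner_sub_right, real_inner_smul_right, real_inner_self_eq_norm_sq] at h
  have hsimp : ε / ‖x‖ * ‖x‖ ^ 2 = ε * ‖x‖ := by field_simp
  linarith

-- A fixed point of the nonexpansive map that sends `x` to the representative of `x - v` in the
-- chamber is a solution; coercivity of `⟪·, v⟫` on the chamber provides the a priori bound.
theorem exists_sub_apply_eq (hW : IsFiniteReflectionGroup W) (hx : x₀ ∈ mirrorCompl W) {v : E}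
    (hv : v ∈ interior (dualCone (chamber W x₀) : Set E)) :
    ∃ w ∈ W, ∃ x ∈ chamber W x₀, x - w x = v := by
  have := hW.finite
  obtain ⟨ε, hε, hcoer⟩ := exists_pos_forall_mul_norm_le_inner hv
  choose g hgW hgC using exists_map_mem_chamber (W := W) x₀
  have hlip : LipschitzWith 1 fun x => g (x - v) (x - v) := LipschitzWith.of_dist_le_mul
    fun x y => by simpa using dist_map_map_le hW hx (hgW _) (hgW _) (hgC (x - v)) (hgC (y - v))
  have hbound : ∀ t : ℝ, 0 ≤ t → t < 1 → ∀ x, t • g (x - v) (x - v) = x →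
      ‖x‖ ≤ ‖v‖ ^ 2 / (2 * ε) := fun t ht0 ht1 x htx => by
    have hxC : x ∈ chamber W x₀ := by
      rw [← htx]
      exact (chamber W x₀).smul_mem ht0 (hgC (x - v))
    have hle : ‖x‖ ≤ ‖x - v‖ := by
      calc ‖x‖ = t * ‖x - v‖ := by
            rw [← (g (x - v)).norm_map (x - v), ← Real.norm_of_nonneg ht0, ← norm_smul, htx]
        _ ≤ ‖x - v‖ := mul_le_of_le_one_left (norm_nonneg _) ht1.le
    have hsq := pow_le_pow_left₀ (norm_nonneg x) hle 2
    rw [norm_sub_sq_real] at hsq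
    rw [le_div_iff₀ (by positivity)]
    linarith [hcoer x hxC]
  obtain ⟨x, hfix⟩ := exists_fixedPoint_of_lipschitzWith_one hlip hbound
  refine ⟨(g (x - v))⁻¹, W.inv_mem (hgW _), x, hfix ▸ hgC _, ?_⟩
  nth_rw 3 [← hfix]
  rw [inv_apply_self, sub_sub_cancel]

theorem sub_apply_mem_dualCone (hW : IsFiniteReflectionGroup W) (hx : x₀ ∈ mirrorCompl W) {y : E}
    (hy : y ∈ chamber W x₀) {w : E ≃ₗᵢ[ℝ] E} (hw : w ∈ W) :
    y - w y ∈ dualCone (chamber W x₀) := by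
  intro x hxC
  rw [innerₗ_apply_apply, inner_sub_right, sub_nonneg]
  exact inner_map_le hW hx hxC hy hw

theorem IsGenericPoint.existsUnique_apply (hW : IsFiniteReflectionGroup W)
    (hx : x₀ ∈ mirrorCompl W) {v : E} (hv : IsGenericPoint W v)
    (hvC : v ∈ interior (dualCone (chamber W x₀) : Set E)) :
    ∃! w : {w : W // fixedSpace (w : E ≃ₗᵢ[ℝ] E) = ⊥},
      ∃ y ∈ chamber W x₀, y - (w : E ≃ₗᵢ[ℝ] E) y = v := by
  obtain ⟨w, hw, y, hyC, hy⟩ := exists_sub_apply_eq hW hx hvC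
  obtain ⟨hfix, hreg⟩ := hv w hw y hy
  refine ⟨⟨⟨w, hw⟩, hfix⟩, ⟨y, hyC, hy⟩, fun u ⟨z, hzC, hz⟩ => Subtype.ext (Subtype.ext ?_)⟩
  exact (eq_of_sub_apply_eq hW hx hreg hyC hzC hw u.1.2 hfix (hy.trans hz.symm)).symm

theorem IsGenericPoint.existsUnique_chamber (hW : IsFiniteReflectionGroup W)
    (hx : x₀ ∈ mirrorCompl W) {v : E} (hv : IsGenericPoint W v) {w : E ≃ₗᵢ[ℝ] E} (hw : w ∈ W)
    (hfix : fixedSpace w = ⊥) :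
    ∃! g : W, ∃ y ∈ chamber W ((g : E ≃ₗᵢ[ℝ] E) x₀), y - w y = v := by
  have hbij : Function.Bijective fun y => y - w y :=
    ⟨LinearMap.ker_eq_bot.mp hfix,
      LinearMap.range_eq_top.mp (LinearMap.ker_eq_bot_iff_range_eq_top.mp hfix)⟩
  obtain ⟨y, hy, hyuniq⟩ := hbij.existsUnique v
  obtain ⟨g, hg, hguniq⟩ := existsUnique_mem_chamber_apply hW hx (hv w hw y hy).2
  exact ⟨g, ⟨y, hg, hy⟩, fun h ⟨z, hzC, hz⟩ => hguniq h (hyuniq z hz ▸ hzC)⟩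

theorem IsGenericPoint.card_mem_dualCone (hW : IsFiniteReflectionGroup W)
    (hx : x₀ ∈ mirrorCompl W) {v : E} (hv : IsGenericPoint W v)
    (hfr : ∀ g : W, v ∉ frontier (dualCone (chamber W ((g : E ≃ₗᵢ[ℝ] E) x₀)) : Set E)) :
    Nat.card {g : W // v ∈ dualCone (chamber W ((g : E ≃ₗᵢ[ℝ] E) x₀))} =
      Nat.card {w : W // fixedSpace (w : E ≃ₗᵢ[ℝ] E) = ⊥} := by
  have hex (g : {g : W // v ∈ dualCone (chamber W ((g : E ≃ₗᵢ[ℝ] E) x₀))}) :=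
    hv.existsUnique_apply hW (map_mem_mirrorCompl g.1.2 hx)
      (by_contra fun h => hfr g ⟨subset_closure g.2, h⟩)
  choose φ hφ hφuniq using hex
  refine Nat.card_eq_of_bijective φ ⟨fun g h hgh => ?_, fun w => ?_⟩
  · refine Subtype.ext ((hv.existsUnique_chamber hW hx (φ g).1.2 (φ g).2).unique (hφ g) ?_)
    exact hgh ▸ hφ h
  · obtain ⟨g, ⟨y, hyC, rfl⟩, -⟩ := hv.existsUnique_chamber hW hx w.1.2 w.2
    have hmem := sub_apply_mem_dualCone hW (map_mem_mirrorCompl g.2 hx) hyC w.1.2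
    exact ⟨⟨g, hmem⟩, (hφuniq ⟨g, hmem⟩ w ⟨y, hyC, rfl⟩).symm⟩

theorem mem_dualCone_chamber_apply_iff {g : E ≃ₗᵢ[ℝ] E} (hg : g ∈ W) {v : E} :
    v ∈ dualCone (chamber W (g x₀)) ↔ g⁻¹ v ∈ dualCone (chamber W x₀) := by
  refine ⟨fun hv x hxC => ?_, fun hv x hxC => ?_⟩
  · rw [innerₗ_apply_apply, ← inner_isometry_left]
    exact hv ((mem_chamber_apply_iff hg).mpr (by rwa [inv_apply_self]))
  · rw [innerₗ_apply_apply, ← (g⁻¹).inner_map_map]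
    exact hv ((mem_chamber_apply_iff hg).mp hxC)

variable [MeasurableSpace E] [BorelSpace E]

theorem ae_isGenericPoint [Finite W] : ∀ᵐ v : E, IsGenericPoint W v := by
  have hroots : Countable (unitRoots W) := finite_unitRoots.countable
  let d (w : W) : E →ₗ[ℝ] E := LinearMap.id - ((w : E ≃ₗᵢ[ℝ] E).toLinearEquiv : E →ₗ[ℝ] E)
  have hsingular : ∀ᵐ v : E, ∀ w : W, fixedSpace (w : E ≃ₗᵢ[ℝ] E) ≠ ⊥ → v ∉ LinearMap.range (d w) :=
    ae_all_iff.mpr fun w => Filter.eventually_imp_distrib_left.mpr fun hw =>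
      ae_notMem_submodule fun h => hw (LinearMap.ker_eq_bot_iff_range_eq_top.mpr h)
  have hmirror : ∀ᵐ v : E, ∀ w : W, ∀ a : unitRoots W, v ∉ (ℝ ∙ (a : E))ᗮ.map (d w) := by
    refine ae_all_iff.mpr fun w => ae_all_iff.mpr fun a => ae_notMem_submodule fun h => ?_
    have hne : (ℝ ∙ (a : E))ᗮ ≠ ⊤ := by
      simpa [Submodule.orthogonal_eq_top_iff] using ne_zero_of_mem_unitRoots a.2
    have hle := Submodule.finrank_map_le (d w) (ℝ ∙ (a : E))ᗮ
    rw [h, finrank_top] at hle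
    exact hle.not_gt (Submodule.finrank_lt hne)
  filter_upwards [hsingular, hmirror] with v hv hv' w hw x hx
  refine ⟨by_contra fun h => hv ⟨w, hw⟩ h ⟨x, hx⟩, mem_mirrorCompl_iff.mpr fun a ha h => ?_⟩
  exact hv' ⟨w, hw⟩ ⟨a, ha⟩ ⟨x, Submodule.mem_orthogonal_singleton_iff_inner_right.mpr h, hx⟩

theorem card_mul_ballFraction_dualCone (hW : IsFiniteReflectionGroup W)
    (hx : x₀ ∈ mirrorCompl W) :
    Nat.card W * ballFraction (dualCone (chamber W x₀) : Set E) =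
      Nat.card {w : W // fixedSpace (w : E ≃ₗᵢ[ℝ] E) = ⊥} := by
  have := hW.finite
  have := Fintype.ofFinite W
  have hfr : ∀ᵐ v : E, ∀ g : W, v ∉ frontier (dualCone (chamber W (g.1 x₀)) : Set E) :=
    ae_all_iff.mpr fun g =>
      measure_eq_zero_iff_ae_notMem.mp ((dualCone (chamber W (g.1 x₀))).convex.addHaar_frontier _)
  have hfrac (g : W) : ballFraction (dualCone (chamber W (g.1 x₀)) : Set E) =
      ballFraction (dualCone (chamber W x₀) : Set E) := by
    rw [← ballFraction_preimage (g⁻¹ : W).1 (dualCone (chamber W x₀) : Set E)]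
    exact congrArg ballFraction (Set.ext fun v => mem_dualCone_chamber_apply_iff g.2)
  have hsum := sum_ballFraction_of_ae_card_eq
    (fun g : W => (isClosed_dualCone (chamber W (g.1 x₀))).measurableSet) (by
      filter_upwards [ae_isGenericPoint (W := W), hfr] with v hv hvfr
      exact hv.card_mem_dualCone hW hx hvfr)
  rwa [Finset.sum_congr rfl fun g _ => hfrac g, Finset.sum_const, Finset.card_univ, nsmul_eq_mul,
    ← Nat.card_eq_fintype_card] at hsum

end DualChamber

section Faces

variable {E : Type*} [NormedAddCommGroup E] [InnerProductSpace ℝ E]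
  {W : Subgroup (E ≃ₗᵢ[ℝ] E)} {x₀ : E} {C F F' : PointedCone ℝ E}

theorem exists_mem_sub_eq_of_mem_linSpan {y : E} (hy : y ∈ linSpan C) :
    ∃ a ∈ C, ∃ b ∈ C, a - b = y := by
  induction hy using Submodule.span_induction with
  | mem a ha => exact ⟨a, ha, 0, C.zero_mem, sub_zero a⟩
  | zero => exact ⟨0, C.zero_mem, 0, C.zero_mem, sub_zero 0⟩
  | add _ _ _ _ h h' =>
    obtain ⟨a, ha, b, hb, rfl⟩ := h
    obtain ⟨a', ha', b', hb', rfl⟩ := h'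
    exact ⟨a + a', C.add_mem ha ha', b + b', C.add_mem hb hb', add_sub_add_comm a a' b b'⟩
  | smul c _ _ h =>
    obtain ⟨a, ha, b, hb, rfl⟩ := h
    rcases le_total 0 c with hc | hc
    · exact ⟨c • a, C.smul_mem hc ha, c • b, C.smul_mem hc hb, (smul_sub c a b).symm⟩
    · refine ⟨-c • b, C.smul_mem (neg_nonneg.mpr hc) hb, -c • a,
        C.smul_mem (neg_nonneg.mpr hc) ha, by module⟩

theorem mem_face_iff (hF : F.IsFaceOf C) {y : E} : y ∈ F ↔ y ∈ C ∧ y ∈ linSpan F := by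
  refine ⟨fun hy => ⟨hF.le hy, Submodule.subset_span hy⟩, fun ⟨hyC, hy⟩ => ?_⟩
  obtain ⟨a, ha, b, hb, rfl⟩ := exists_mem_sub_eq_of_mem_linSpan hy
  exact hF.mem_of_add_mem_left hyC (hF.le hb) (by rwa [sub_add_cancel])

theorem face_ext (hF : F.IsFaceOf C) (hF' : F'.IsFaceOf C) (h : linSpan F = linSpan F') :
    F = F' := by
  ext y
  rw [mem_face_iff hF, mem_face_iff hF', h]

theorem eventually_smul_add_mem_chamber [Finite W] {p z : E} (hp : p ∈ chamber W x₀)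
    (hz : ∀ v ∈ posRoots W x₀, ⟪v, p⟫ = 0 → 0 ≤ ⟪v, z⟫) :
    ∀ᶠ M : ℝ in Filter.atTop, M • p + z ∈ chamber W x₀ := by
  refine (Filter.eventually_all_finite finite_posRoots).mpr fun v hv => ?_
  simp only [innerₗ_apply_apply, inner_add_right, real_inner_smul_right]
  rcases (mem_chamber.mp hp v hv).eq_or_lt with hvp | hvp
  · exact Filter.Eventually.of_forall fun M => by
      rw [← hvp, mul_zero, zero_add]
      exact hz v hv hvp.symm
  · exact (Filter.tendsto_atTop_add_const_right _ _
      (Filter.tendsto_id.atTop_mul_const hvp)).eventually_ge_atTop 0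

/-- The intersection of the mirrors of `W` that contain `x`. -/
def mirrorFlat (W : Subgroup (E ≃ₗᵢ[ℝ] E)) (x : E) : Submodule ℝ E :=
  ⨅ v ∈ {v | v ∈ unitRoots W ∧ ⟪v, x⟫ = 0}, (ℝ ∙ v)ᗮ

theorem mem_mirrorFlat {x y : E} :
    y ∈ mirrorFlat W x ↔ ∀ v ∈ unitRoots W, ⟪v, x⟫ = 0 → ⟪v, y⟫ = 0 := by
  simp [mirrorFlat, Submodule.mem_orthogonal_singleton_iff_inner_right]

theorem mem_mirrorFlat_iff_forall_posRoots (hx : x₀ ∈ mirrorCompl W) {x y : E} :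
    y ∈ mirrorFlat W x ↔ ∀ v ∈ posRoots W x₀, ⟪v, x⟫ = 0 → ⟪v, y⟫ = 0 := by
  refine mem_mirrorFlat.trans ⟨fun h v hv => h v hv.1, fun h v hv hvx => ?_⟩
  rcases mem_posRoots_or_neg_mem hx hv with hpos | hneg
  · exact h v hpos hvx
  · simpa using h _ hneg (by simpa using hvx)

theorem mem_mirrorFlat_self (x : E) : x ∈ mirrorFlat W x := mem_mirrorFlat.mpr fun _ _ h => h

theorem mirrorFlat_le_mirrorFlat {x y : E} (h : y ∈ mirrorFlat W x) :
    mirrorFlat W y ≤ mirrorFlat W x := fun _ hz =>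
  mem_mirrorFlat.mpr fun v hv hvx => mem_mirrorFlat.mp hz v hv (mem_mirrorFlat.mp h v hv hvx)

theorem finite_range_mirrorFlat [Finite W] : (Set.range (mirrorFlat W)).Finite := by
  refine ((finite_unitRoots (W := W)).finite_subsets.image
    fun S => ⨅ v ∈ S, (ℝ ∙ v)ᗮ).subset (Set.range_subset_iff.mpr fun x => ?_)
  exact ⟨{v | v ∈ unitRoots W ∧ ⟪v, x⟫ = 0}, fun v hv => hv.1, rfl⟩

theorem mem_image_iff {w : E ≃ₗᵢ[ℝ] E} {U : Submodule ℝ E} {x : E} :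
    x ∈ image w U ↔ w⁻¹ x ∈ U :=
  Submodule.mem_map_equiv U

theorem image_mirrorFlat {w : E ≃ₗᵢ[ℝ] E} (hw : w ∈ W) (x : E) :
    image w (mirrorFlat W x) = mirrorFlat W (w x) := by
  ext y
  rw [mem_image_iff, mem_mirrorFlat, mem_mirrorFlat]
  refine ⟨fun h v hv hvx => ?_, fun h v hv hvx => ?_⟩
  · rw [← (w⁻¹).inner_map_map]
    exact h _ (map_mem_unitRoots (W.inv_mem hw) hv) (by rwa [inner_isometry_left, inv_inv])
  · rw [← inner_isometry_left]
    exact h _ (map_mem_unitRoots hw hv) (by rwa [w.inner_map_map])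

theorem mem_pointFixer_mirrorFlat (hW : IsFiniteReflectionGroup W) (hx : x₀ ∈ mirrorCompl W)
    {w : E ≃ₗᵢ[ℝ] E} (hw : w ∈ W) {x : E} (hwx : w x = x) :
    w ∈ pointFixer W (mirrorFlat W x) :=
  ⟨hw, fun _ hy => apply_eq_of_mem_reflGroup (fun v hv => mem_mirrorFlat.mp hy v hv.1 hv.2)
    (mem_reflGroup_of_apply_eq hW hx hw hwx)⟩

theorem exists_mem_face_forall_mem_mirrorFlat [Finite W] (hx : x₀ ∈ mirrorCompl W)
    (hF : F.IsFaceOf (chamber W x₀)) : ∃ p ∈ F, ∀ u ∈ F, u ∈ mirrorFlat W p := by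
  have hwitness : ∀ v : E, ∃ f ∈ F, ⟪v, f⟫ = 0 → ∀ u ∈ F, ⟪v, u⟫ = 0 := fun v => by
    by_contra! h
    obtain ⟨-, u, hu, hvu⟩ := h 0 F.zero_mem
    exact hvu ((h u hu).1)
  choose f hfF hf using hwitness
  let p : E := ∑ b ∈ (finite_posRoots (W := W) (x₀ := x₀)).toFinset, f b
  refine ⟨p, Submodule.sum_mem _ fun b _ => hfF b, fun u hu =>
    (mem_mirrorFlat_iff_forall_posRoots hx).mpr fun v hv hvp => hf v ?_ u hu⟩
  rw [inner_sum, Finset.sum_eq_zero_iff_of_nonneg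
    fun b _ => mem_chamber.mp (hF.le (hfF b)) v hv] at hvp
  exact hvp v (finite_posRoots.mem_toFinset.mpr hv)

theorem exists_linSpan_face_eq_mirrorFlat [Finite W] (hx : x₀ ∈ mirrorCompl W)
    (hF : F.IsFaceOf (chamber W x₀)) : ∃ p ∈ F, linSpan F = mirrorFlat W p := by
  obtain ⟨p, hpF, hp⟩ := exists_mem_face_forall_mem_mirrorFlat hx hF
  refine ⟨p, hpF, le_antisymm (Submodule.span_le.mpr hp) fun z hz => ?_⟩
  have hlarge : ∀ y ∈ mirrorFlat W p, ∀ᶠ M : ℝ in Filter.atTop, M • p + y ∈ chamber W x₀ :=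
    fun y hy => eventually_smul_add_mem_chamber (hF.le hpF) fun v hv hvp =>
      (mem_mirrorFlat.mp hy v hv.1 hvp).ge
  obtain ⟨M, ⟨hadd, hsub⟩, hM⟩ := (((hlarge z hz).and (hlarge (-z) (neg_mem hz))).and
    (Filter.eventually_ge_atTop 0)).exists
  have hMp : M • p ∈ F := F.smul_mem hM hpF
  have hMpz : M • p + z ∈ F := hF.mem_of_add_mem_left hadd hsub (by
    rw [add_add_add_comm, add_neg_cancel, add_zero]
    exact F.add_mem hMp hMp)
  rw [← add_sub_cancel_left (M • p) z]
  exact sub_mem (Submodule.subset_span hMpz) (Submodule.subset_span hMp)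

theorem finite_faces [Finite W] (hx : x₀ ∈ mirrorCompl W) (k : ℕ) :
    (faces (chamber W x₀) k).Finite := by
  refine Set.Finite.of_injOn (f := linSpan) (fun F hF => ?_)
    (fun F hF F' hF' h => face_ext hF.1 hF'.1 h) (finite_range_mirrorFlat (W := W))
  obtain ⟨p, -, hp⟩ := exists_linSpan_face_eq_mirrorFlat hx hF.1
  exact ⟨p, hp.symm⟩

theorem exists_face_linSpan_eq_mirrorFlat [Finite W] (hx : x₀ ∈ mirrorCompl W) {c : E}
    (hc : c ∈ chamber W x₀) :
    ∃ F : PointedCone ℝ E, F.IsFaceOf (chamber W x₀) ∧ linSpan F = mirrorFlat W c := by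
  let F : PointedCone ℝ E := chamber W x₀ ⊓ PointedCone.ofSubmodule (mirrorFlat W c)
  have hface : F.IsFaceOf (chamber W x₀) := by
    refine PointedCone.IsFaceOf.of_mem_of_add_mem_left inf_le_left fun {y z} hy hz hyz => ⟨hy, ?_⟩
    refine (mem_mirrorFlat_iff_forall_posRoots hx).mpr fun v hv hvc => ?_
    have hsum := mem_mirrorFlat.mp hyz.2 v hv.1 hvc
    rw [inner_add_right] at hsum
    linarith [mem_chamber.mp hy v hv, mem_chamber.mp hz v hv]
  refine ⟨F, hface, le_antisymm (Submodule.span_le.mpr fun y hy => hy.2) fun z hz => ?_⟩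
  obtain ⟨M, hM⟩ := (eventually_smul_add_mem_chamber hc fun v hv hvc =>
    (mem_mirrorFlat.mp hz v hv.1 hvc).ge).exists
  have hcF : c ∈ F := ⟨hc, mem_mirrorFlat_self c⟩
  have hMz : M • c + z ∈ F :=
    ⟨hM, add_mem ((mirrorFlat W c).smul_mem M (mem_mirrorFlat_self c)) hz⟩
  rw [← add_sub_cancel_left (M • c) z]
  exact sub_mem (Submodule.subset_span hMz)
    (Submodule.smul_mem _ M (Submodule.subset_span hcF))

end Faces

section ClassAngle

variable {E : Type*} [NormedAddCommGroup E] [InnerProductSpace ℝ E]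
  {W : Subgroup (E ≃ₗᵢ[ℝ] E)} {x₀ : E} {C F F' : PointedCone ℝ E}

/-- `u` is a point of `U` that lies only on those mirrors that contain `U`. -/
def IsGenericIn (W : Subgroup (E ≃ₗᵢ[ℝ] E)) (U : Submodule ℝ E) (u : E) : Prop :=
  u ∈ U ∧ U ≤ mirrorFlat W u

theorem IsGenericIn.mirrorFlat_eq {U : Submodule ℝ E} {u x : E} (hu : IsGenericIn W U u)
    (hU : U = mirrorFlat W x) : mirrorFlat W u = U :=
  le_antisymm (hU ▸ mirrorFlat_le_mirrorFlat (hU ▸ hu.1)) hu.2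

theorem IsGenericIn.card_apply_mem_chamber (hW : IsFiniteReflectionGroup W)
    (hx : x₀ ∈ mirrorCompl W) {U : Submodule ℝ E} {u : E} (hu : IsGenericIn W U u) :
    Nat.card {g : W // (g : E ≃ₗᵢ[ℝ] E) u ∈ chamber W x₀} = Nat.card (pointFixer W U) := by
  have := hW.finite
  obtain ⟨g₀, hg₀, hg₀u⟩ := exists_map_mem_chamber (W := W) x₀ u
  let φ (p : pointFixer W U) : {g : W // (g : E ≃ₗᵢ[ℝ] E) u ∈ chamber W x₀} :=
    ⟨⟨g₀ * p, W.mul_mem hg₀ p.2.1⟩, by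
      rwa [LinearIsometryEquiv.coe_mul, Function.comp_apply, p.2.2 u hu.1]⟩
  refine (Nat.card_eq_of_bijective φ ⟨fun p q hpq => ?_, fun ⟨⟨g, hg⟩, hgu⟩ => ?_⟩).symm
  · exact Subtype.ext (mul_left_cancel (congrArg (fun g => (g.1 : E ≃ₗᵢ[ℝ] E)) hpq))
  · have hfold : g u = g₀ u := by
      have h := eq_of_mem_chamber hW hx (W.mul_mem hg (W.inv_mem hg₀)) hg₀u
      rw [LinearIsometryEquiv.coe_mul, Function.comp_apply, inv_apply_self] at h
      exact h hgu
    have hfix : (g₀⁻¹ * g) u = u := by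
      rw [LinearIsometryEquiv.coe_mul, Function.comp_apply, hfold, inv_apply_self]
    have hmem := mem_pointFixer_mirrorFlat hW hx (W.mul_mem (W.inv_mem hg₀) hg) hfix
    exact ⟨⟨g₀⁻¹ * g, hmem.1, fun z hz => hmem.2 z (hu.2 hz)⟩,
      Subtype.ext (Subtype.ext (mul_inv_cancel_left g₀ g))⟩

theorem IsGenericIn.exists_face [Finite W] (hx : x₀ ∈ mirrorCompl W)
    (hF : F.IsFaceOf (chamber W x₀)) {u : E} (hu : IsGenericIn W (linSpan F) u)
    {g : E ≃ₗᵢ[ℝ] E} (hg : g ∈ W) (hgu : g u ∈ chamber W x₀) :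
    ∃ F' : PointedCone ℝ E, F'.IsFaceOf (chamber W x₀) ∧ image g (linSpan F) = linSpan F' := by
  obtain ⟨F', hF', hspan'⟩ := exists_face_linSpan_eq_mirrorFlat hx hgu
  obtain ⟨p, -, hspan⟩ := exists_linSpan_face_eq_mirrorFlat hx hF
  exact ⟨F', hF', by rw [hspan', ← image_mirrorFlat hg, hu.mirrorFlat_eq hspan]⟩

theorem image_mul (a b : E ≃ₗᵢ[ℝ] E) (U : Submodule ℝ E) :
    image (a * b) U = image a (image b U) :=
  Submodule.map_comp _ _ U

theorem image_one (U : Submodule ℝ E) : image 1 U = U := Submodule.map_id U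

theorem image_inv_of_eq {w : E ≃ₗᵢ[ℝ] E} {U U' : Submodule ℝ E} (h : image w U = U') :
    image w⁻¹ U' = U := by
  rw [← h, ← image_mul, inv_mul_cancel, image_one]

theorem finrank_image (g : E ≃ₗᵢ[ℝ] E) (U : Submodule ℝ E) :
    Module.finrank ℝ (image g U) = Module.finrank ℝ U :=
  LinearEquiv.finrank_map_eq g.toLinearEquiv U

theorem card_image_eq {U U' : Submodule ℝ E} {g : E ≃ₗᵢ[ℝ] E} (hg : g ∈ W)
    (hU : image g U = U') :
    Nat.card {h : W // image (h : E ≃ₗᵢ[ℝ] E) U = U'} = Nat.card (normalizer W U) :=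
  Nat.card_congr {
    toFun h := ⟨g⁻¹ * h.1, W.mul_mem (W.inv_mem hg) h.1.2, by
      rw [image_mul, h.2, image_inv_of_eq hU]⟩
    invFun n := ⟨⟨g * n, W.mul_mem hg n.2.1⟩, by rw [image_mul, n.2.2, hU]⟩
    left_inv h := Subtype.ext (Subtype.ext (mul_inv_cancel_left _ _))
    right_inv n := Subtype.ext (inv_mul_cancel_left _ _) }

theorem card_normalizer_ne_zero [Finite W] {L : Submodule ℝ E} :
    Nat.card (normalizer W L) ≠ 0 := by
  have : Finite (normalizer W L) :=
    (Set.toFinite (W : Set (E ≃ₗᵢ[ℝ] E))).subset fun _ hw => hw.1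
  exact Nat.card_pos.ne'

variable [FiniteDimensional ℝ E] [MeasurableSpace E] [BorelSpace E]

theorem ae_isGenericIn [Finite W] (U : Submodule ℝ E) : ∀ᵐ u : U, IsGenericIn W U u := by
  have hroots : Countable (unitRoots W) := finite_unitRoots.countable
  have hmirror : ∀ᵐ u : U, ∀ v : unitRoots W, ⟪(v : E), (u : E)⟫ = 0 → ∀ z ∈ U, ⟪(v : E), z⟫ = 0 :=
    ae_all_iff.mpr fun v => by
      by_cases hv : ∀ z ∈ U, ⟪(v : E), z⟫ = 0
      · exact Filter.Eventually.of_forall fun _ _ => hv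
      have hne : (ℝ ∙ (v : E))ᗮ.comap U.subtype ≠ ⊤ := fun h => hv fun z hz =>
        Submodule.mem_orthogonal_singleton_iff_inner_right.mp
          (Submodule.eq_top_iff'.mp h ⟨z, hz⟩)
      filter_upwards [ae_notMem_submodule hne] with u hu h0
      exact absurd (Submodule.mem_orthogonal_singleton_iff_inner_right.mpr h0) hu
  filter_upwards [hmirror] with u hu
  exact ⟨u.2, fun z hz => mem_mirrorFlat.mpr fun v hv hvu => hu ⟨v, hv⟩ hvu z hz⟩

theorem sum_ballFraction_apply_mem_chamber [Fintype W] (hW : IsFiniteReflectionGroup W)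
    (hx : x₀ ∈ mirrorCompl W) (U : Submodule ℝ E) :
    ∑ g : W, ballFraction {u : U | (g : E ≃ₗᵢ[ℝ] E) u ∈ chamber W x₀} =
      Nat.card (pointFixer W U) := by
  refine sum_ballFraction_of_ae_card_eq (fun g => ?_) ?_
  · exact (isClosed_chamber.preimage (g.1.continuous.comp continuous_subtype_val)).measurableSet
  · filter_upwards [ae_isGenericIn (W := W) U] with u hu
    exact hu.card_apply_mem_chamber hW hx

theorem ballFraction_image {g : E ≃ₗᵢ[ℝ] E} {U U' : Submodule ℝ E} (h : image g U = U')
    (S : Set E) :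
    ballFraction {u : U | g u ∈ S} = ballFraction {x : U' | (x : E) ∈ S} := by
  subst h
  exact ballFraction_preimage (g.submoduleMap U) {x | (x : E) ∈ S}

theorem relAngle_face (hF : F.IsFaceOf C) :
    relAngle F = ballFraction {x : linSpan F | (x : E) ∈ C} :=
  congrArg ballFraction (Set.ext fun x => (mem_face_iff hF).trans (and_iff_left x.2))

open Classical in
theorem ballFraction_apply_mem_chamber_eq_sum [Finite W] (hx : x₀ ∈ mirrorCompl W) {k : ℕ}
    (hF : F ∈ faces (chamber W x₀) k) {Fs : Finset (PointedCone ℝ E)}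
    (hFs : ∀ F', F' ∈ Fs ↔ F' ∈ faces (chamber W x₀) k ∧ FaceEquiv W F F')
    {g : E ≃ₗᵢ[ℝ] E} (hg : g ∈ W) :
    ballFraction {u : linSpan F | g u ∈ chamber W x₀} =
      ∑ F' ∈ Fs, if image g (linSpan F) = linSpan F' then relAngle F' else 0 := by
  by_cases h : ∃ F' ∈ Fs, image g (linSpan F) = linSpan F'
  · obtain ⟨F', hF', hspan⟩ := h
    have hface : F'.IsFaceOf (chamber W x₀) := ((hFs F').mp hF').1.1
    rw [Finset.sum_eq_single_of_mem F' hF' fun F'' hF'' hne => if_neg fun h => hne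
      (face_ext ((hFs F'').mp hF'').1.1 hface (h.symm.trans hspan)), if_pos hspan]
    exact (ballFraction_image hspan (chamber W x₀)).trans (relAngle_face hface).symm
  · rw [Finset.sum_eq_zero fun F' hF' => if_neg fun hspan => h ⟨F', hF', hspan⟩]
    refine ballFraction_eq_zero ?_
    filter_upwards [ae_isGenericIn (W := W) (linSpan F)] with u hu hgu
    obtain ⟨F', hface, hspan⟩ := hu.exists_face hx hF.1 hg hgu
    refine h ⟨F', (hFs F').mpr ⟨⟨hface, ?_⟩, g, hg, hspan⟩, hspan⟩
    rw [← hspan, finrank_image, hF.2]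

theorem classAngle_mul_card_normalizer (hW : IsFiniteReflectionGroup W)
    (hx : x₀ ∈ mirrorCompl W) {k : ℕ} (hF : F ∈ faces (chamber W x₀) k) :
    classAngle W (chamber W x₀) F k * Nat.card (normalizer W (linSpan F)) =
      Nat.card (pointFixer W (linSpan F)) := by
  classical
  have := hW.finite
  have := Fintype.ofFinite W
  have hfin : {F' | F' ∈ faces (chamber W x₀) k ∧ FaceEquiv W F F'}.Finite :=
    (finite_faces hx k).subset fun F' h => h.1
  have hFs := fun F' => hfin.mem_toFinset (a := F')
  rw [← sum_ballFraction_apply_mem_chamber hW hx, classAngle,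
    finsum_mem_eq_finite_toFinset_sum _ hfin, Finset.sum_mul,
    Finset.sum_congr rfl fun g _ => ballFraction_apply_mem_chamber_eq_sum hx hF hFs g.2,
    Finset.sum_comm]
  refine Finset.sum_congr rfl fun F' hF' => ?_
  obtain ⟨g, hg, hspan⟩ := ((hFs F').mp hF').2
  rw [← Finset.sum_filter, Finset.sum_const, nsmul_eq_mul, mul_comm, ← card_image_eq hg hspan,
    Nat.card_eq_fintype_card, Fintype.card_subtype]

theorem classAngle_eq_div (hW : IsFiniteReflectionGroup W) (hx : x₀ ∈ mirrorCompl W) {k : ℕ}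
    (hF : F ∈ faces (chamber W x₀) k) : classAngle W (chamber W x₀) F k =
      (Nat.card (pointFixer W (linSpan F)) : ℝ) / Nat.card (normalizer W (linSpan F)) :=
  have := hW.finite
  eq_div_of_mul_eq (Nat.cast_ne_zero.mpr card_normalizer_ne_zero)
    (classAngle_mul_card_normalizer hW hx hF)

end ClassAngle

section Restriction

variable {E : Type*} [NormedAddCommGroup E] [InnerProductSpace ℝ E]
  {W : Subgroup (E ≃ₗᵢ[ℝ] E)} {x₀ : E} {F : PointedCone ℝ E} {L : Submodule ℝ E}

theorem apply_mem_orthogonal_of_mem_pointFixer {w : E ≃ₗᵢ[ℝ] E} (hw : w ∈ pointFixer W L) {m : E}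
    (hm : m ∈ Lᗮ) : w m ∈ Lᗮ := by
  rw [Submodule.mem_orthogonal'] at hm ⊢
  intro u hu
  rw [inner_isometry_left, ((pointFixer W L).inv_mem hw).2 u hu]
  exact hm u hu

/-- The action of the pointwise fixer of `L` on the orthogonal complement of `L`. -/
def restrictOrthogonal (W : Subgroup (E ≃ₗᵢ[ℝ] E)) (L : Submodule ℝ E) :
    pointFixer W L →* (Lᗮ ≃ₗᵢ[ℝ] Lᗮ) where
  toFun w :=
    { toFun m := ⟨w.1 m, apply_mem_orthogonal_of_mem_pointFixer w.2 m.2⟩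
      invFun m := ⟨w.1⁻¹ m, apply_mem_orthogonal_of_mem_pointFixer (inv_mem w.2) m.2⟩
      map_add' a b := Subtype.ext (map_add w.1 (a : E) b)
      map_smul' c a := Subtype.ext (map_smul w.1 c (a : E))
      left_inv m := Subtype.ext (inv_apply_self w.1 m)
      right_inv m := Subtype.ext (apply_inv_self w.1 m)
      norm_map' m := w.1.norm_map m }
  map_one' := rfl
  map_mul' _ _ := rfl

theorem coe_restrictOrthogonal_apply (w : pointFixer W L) (m : Lᗮ) :
    (restrictOrthogonal W L w m : E) = (w : E ≃ₗᵢ[ℝ] E) m := rfl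

theorem coe_refl_apply {v : Lᗮ} (m : Lᗮ) : (refl v m : E) = refl (v : E) m := by
  rw [refl_apply, refl_apply]
  rfl

theorem refl_mem_pointFixer {v : Lᗮ} (hv : refl (v : E) ∈ W) : refl (v : E) ∈ pointFixer W L :=
  ⟨hv, fun u hu => (refl_eq_self_iff (v : E) u).mpr (Submodule.inner_left_of_mem_orthogonal hu v.2)⟩

theorem restrictOrthogonal_refl {v : Lᗮ} (hv : refl (v : E) ∈ W) :
    restrictOrthogonal W L ⟨refl (v : E), refl_mem_pointFixer hv⟩ = refl v := by
  ext m
  rw [coe_restrictOrthogonal_apply, coe_refl_apply]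

theorem fixedSpace_restrictOrthogonal_eq_bot_iff (w : pointFixer W L) :
    fixedSpace (restrictOrthogonal W L w) = ⊥ ↔ fixedSpace (w : E ≃ₗᵢ[ℝ] E) ⊓ Lᗮ = ⊥ := by
  simp only [Submodule.eq_bot_iff, Submodule.mem_inf, mem_fixedSpace, Subtype.forall, and_imp,
    Subtype.ext_iff, coe_restrictOrthogonal_apply, ZeroMemClass.coe_zero]
  exact forall_congr' fun x => forall_comm

theorem mem_orthogonal_mirrorFlat {x v : E} (hv : v ∈ unitRoots W) (hvx : ⟪v, x⟫ = 0) :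
    v ∈ (mirrorFlat W x)ᗮ :=
  (Submodule.mem_orthogonal' _ _).mpr fun _ hu => mem_mirrorFlat.mp hu v hv hvx

variable [FiniteDimensional ℝ E]

theorem isometry_ext_of_orthogonal {w w' : E ≃ₗᵢ[ℝ] E} (h : ∀ x ∈ L, w x = w' x)
    (h' : ∀ x ∈ Lᗮ, w x = w' x) : w = w' := by
  ext x
  obtain ⟨y, hy, z, hz, rfl⟩ := L.exists_add_mem_mem_orthogonal x
  rw [map_add, map_add, h y hy, h' z hz]

theorem restrictOrthogonal_injective : Function.Injective (restrictOrthogonal W L) := fun a b h =>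
  Subtype.ext (isometry_ext_of_orthogonal (L := L)
    (fun x hx => (a.2.2 x hx).trans (b.2.2 x hx).symm)
    fun x hx => congrArg (fun f : Lᗮ ≃ₗᵢ[ℝ] Lᗮ => (f ⟨x, hx⟩ : E)) h)

theorem refl_mem_range_restrictOrthogonal {v : Lᗮ} :
    refl v ∈ (restrictOrthogonal W L).range ↔ refl (v : E) ∈ W := by
  refine ⟨fun ⟨w, hw⟩ => ?_, fun hv => ⟨_, restrictOrthogonal_refl hv⟩⟩
  have hext : refl (v : E) = w := by
    refine isometry_ext_of_orthogonal (L := L) (fun x hx => ?_) fun x hx => ?_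
    · rw [w.2.2 x hx, refl_eq_self_iff]
      exact Submodule.inner_left_of_mem_orthogonal hx v.2
    · rw [← coe_refl_apply ⟨x, hx⟩, ← hw, coe_restrictOrthogonal_apply]
  exact hext ▸ w.2.1

theorem mem_unitRoots_range {v : Lᗮ} :
    v ∈ unitRoots (restrictOrthogonal W L).range ↔ (v : E) ∈ unitRoots W :=
  and_congr Iff.rfl refl_mem_range_restrictOrthogonal

theorem isFiniteReflectionGroup_range (hW : IsFiniteReflectionGroup W) (hx : x₀ ∈ mirrorCompl W)
    (p : E) : IsFiniteReflectionGroup (restrictOrthogonal W (mirrorFlat W p)).range := by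
  set ρ := restrictOrthogonal W (mirrorFlat W p)
  have := hW.finite
  have : Finite (pointFixer W (mirrorFlat W p)) :=
    Set.Finite.subset (Set.toFinite (W : Set (E ≃ₗᵢ[ℝ] E))) fun w hw => hw.1
  refine ⟨Set.finite_range ρ, (fun v => refl v) '' unitRoots ρ.range, ?_, le_antisymm ?_ ?_⟩
  · rintro _ ⟨v, hv, rfl⟩
    exact ⟨v, ne_zero_of_mem_unitRoots hv, rfl⟩
  · rintro _ ⟨w, rfl⟩
    have hgen : reflGroup {a | a ∈ unitRoots W ∧ ⟪a, p⟫ = 0} ≤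
        ((reflGroup (unitRoots ρ.range)).comap ρ).map (pointFixer W (mirrorFlat W p)).subtype := by
      refine (Subgroup.closure_le _).mpr ?_
      rintro _ ⟨v, ⟨hv, hvp⟩, rfl⟩
      let v' : (mirrorFlat W p)ᗮ := ⟨v, mem_orthogonal_mirrorFlat hv hvp⟩
      refine ⟨⟨refl v, refl_mem_pointFixer (v := v') hv.2⟩, ?_, rfl⟩
      rw [SetLike.mem_coe, Subgroup.mem_comap, restrictOrthogonal_refl (v := v') hv.2]
      exact refl_mem_reflGroup (mem_unitRoots_range.mpr hv)
    obtain ⟨w', hw', hww'⟩ :=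
      hgen (mem_reflGroup_of_apply_eq hW hx w.2.1 (w.2.2 p (mem_mirrorFlat_self p)))
    exact Subtype.ext hww' ▸ hw'
  · refine (Subgroup.closure_le ρ.range).mpr ?_
    rintro _ ⟨v, hv, rfl⟩
    exact hv.2

theorem orthogonalProjectionOnto_mem_mirrorCompl (hx : x₀ ∈ mirrorCompl W) :
    Lᗮ.orthogonalProjectionOnto x₀ ∈ mirrorCompl (restrictOrthogonal W L).range :=
  mem_mirrorCompl_iff.mpr fun v hv => by
    rw [Submodule.inner_orthogonalProjectionOnto_eq_of_mem_left]
    exact mem_mirrorCompl_iff.mp hx v (mem_unitRoots_range.mp hv)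

theorem mem_posRoots_range {v : Lᗮ} :
    v ∈ posRoots (restrictOrthogonal W L).range (Lᗮ.orthogonalProjectionOnto x₀) ↔
      (v : E) ∈ posRoots W x₀ :=
  and_congr mem_unitRoots_range (by rw [Submodule.inner_orthogonalProjectionOnto_eq_of_mem_left])

theorem quotCone_chamber [Finite W] (hx : x₀ ∈ mirrorCompl W)
    (hF : F.IsFaceOf (chamber W x₀)) :
    quotCone (chamber W x₀) F = chamber (restrictOrthogonal W (linSpan F)).range
      ((linSpan F)ᗮ.orthogonalProjectionOnto x₀) := by
  refine le_antisymm ?_ fun y hy => ?_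
  · rintro _ ⟨c, hc, rfl⟩
    refine mem_chamber.mpr fun v hv => ?_
    exact (Submodule.inner_orthogonalProjectionOnto_eq_of_mem_left v c).symm ▸
      mem_chamber.mp hc v (mem_posRoots_range.mp hv)
  · obtain ⟨p, hpF, hp⟩ := exists_linSpan_face_eq_mirrorFlat hx hF
    have hroots : ∀ v ∈ posRoots W x₀, ⟪v, p⟫ = 0 → 0 ≤ ⟪v, (y : E)⟫ := fun v hv hvp =>
      mem_chamber.mp hy ⟨v, hp ▸ mem_orthogonal_mirrorFlat hv.1 hvp⟩ (mem_posRoots_range.mpr hv)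
    obtain ⟨M, hM⟩ := (eventually_smul_add_mem_chamber (hF.le hpF) hroots).exists
    have hp0 : (linSpan F)ᗮ.orthogonalProjectionOnto p = 0 :=
      Submodule.orthogonalProjectionOnto_eq_zero_iff.mpr
        (Submodule.le_orthogonal_orthogonal _ (Submodule.subset_span hpF))
    refine PointedCone.mem_map.mpr ⟨M • p + y, hM, ?_⟩
    change (linSpan F)ᗮ.orthogonalProjectionOnto (M • p + (y : E)) = y
    rw [map_add, map_smul, hp0, smul_zero, zero_add,
      Submodule.orthogonalProjectionOnto_mem_subspace_eq_self]

theorem linSpan_dualCone_quotCone [Finite W] (hx : x₀ ∈ mirrorCompl W)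
    (hF : F.IsFaceOf (chamber W x₀)) : linSpan (dualCone (quotCone (chamber W x₀) F)) = ⊤ := by
  rw [← Submodule.orthogonal_eq_bot_iff, Submodule.eq_bot_iff]
  intro z hz
  suffices hzL : (z : E) ∈ linSpan F from
    Subtype.ext ((Submodule.orthogonal_disjoint (linSpan F)).le_bot ⟨hzL, z.2⟩)
  obtain ⟨p, -, hp⟩ := exists_linSpan_face_eq_mirrorFlat hx hF
  refine hp.ge ((mem_mirrorFlat_iff_forall_posRoots hx).mpr fun v hv hvp => ?_)
  let v' : (linSpan F)ᗮ := ⟨v, hp ▸ mem_orthogonal_mirrorFlat hv.1 hvp⟩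
  have hdual : v' ∈ dualCone (quotCone (chamber W x₀) F) := mem_dualCone.mpr fun u hu => by
    rw [quotCone_chamber hx hF] at hu
    rw [real_inner_comm]
    exact mem_chamber.mp hu v' (mem_posRoots_range.mpr hv)
  exact (Submodule.mem_orthogonal _ _).mp hz v' (Submodule.subset_span hdual)

theorem card_regSet : Nat.card (regSet W L) =
    Nat.card {w : (restrictOrthogonal W L).range // fixedSpace (w : Lᗮ ≃ₗᵢ[ℝ] Lᗮ) = ⊥} := by
  refine Nat.card_eq_of_bijective (fun w => ⟨⟨restrictOrthogonal W L ⟨w, w.2.1⟩, _, rfl⟩,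
    (fixedSpace_restrictOrthogonal_eq_bot_iff _).mpr w.2.2⟩) ⟨fun a b hab => ?_, ?_⟩
  · have hres : (⟨a, a.2.1⟩ : pointFixer W L) = ⟨b, b.2.1⟩ :=
      restrictOrthogonal_injective (congrArg (fun w => w.1.1) hab)
    exact Subtype.ext (congrArg (fun w : pointFixer W L => (w : E ≃ₗᵢ[ℝ] E)) hres)
  · rintro ⟨⟨_, w, rfl⟩, hw⟩
    exact ⟨⟨w, w.2, (fixedSpace_restrictOrthogonal_eq_bot_iff w).mp hw⟩, rfl⟩

variable [MeasurableSpace E] [BorelSpace E]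

theorem relAngle_eq_ballFraction {K : PointedCone ℝ E} (h : linSpan K = ⊤) :
    relAngle K = ballFraction (K : Set E) :=
  ballFraction_preimage (LinearIsometryEquiv.ofTop E (linSpan K) h) (K : Set E)

theorem card_mul_relAngle_dualCone (hW : IsFiniteReflectionGroup W) (hx : x₀ ∈ mirrorCompl W)
    (hF : F.IsFaceOf (chamber W x₀)) :
    Nat.card (pointFixer W (linSpan F)) * relAngle (dualCone (quotCone (chamber W x₀) F)) =
      Nat.card (regSet W (linSpan F)) := by
  have := hW.finite
  obtain ⟨p, -, hp⟩ := exists_linSpan_face_eq_mirrorFlat hx hF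
  have hrange : IsFiniteReflectionGroup (restrictOrthogonal W (linSpan F)).range :=
    hp ▸ isFiniteReflectionGroup_range hW hx p
  rw [relAngle_eq_ballFraction (linSpan_dualCone_quotCone hx hF), quotCone_chamber hx hF,
    Nat.card_congr (MonoidHom.ofInjective restrictOrthogonal_injective).toEquiv, card_regSet]
  exact card_mul_ballFraction_dualCone hrange (orthogonalProjectionOnto_mem_mirrorCompl hx)

theorem classAngle_mul_relAngle_dualCone (hW : IsFiniteReflectionGroup W)
    (hx : x₀ ∈ mirrorCompl W) {k : ℕ} (hF : F ∈ faces (chamber W x₀) k) :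
    classAngle W (chamber W x₀) F k * relAngle (dualCone (quotCone (chamber W x₀) F)) =
      (Nat.card (regSet W (linSpan F)) : ℝ) / Nat.card (normalizer W (linSpan F)) := by
  rw [classAngle_eq_div hW hx hF, div_mul_eq_mul_div, card_mul_relAngle_dualCone hW hx hF.1]

end Restriction

section Counting

variable {E : Type*} [NormedAddCommGroup E] [InnerProductSpace ℝ E]
  {W : Subgroup (E ≃ₗᵢ[ℝ] E)} {x₀ : E} {L : Submodule ℝ E}

theorem fixedSpace_conj (g w : E ≃ₗᵢ[ℝ] E) :
    fixedSpace (g * w * g⁻¹) = image g (fixedSpace w) := by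
  ext x
  rw [mem_image_iff, mem_fixedSpace, mem_fixedSpace]
  exact g.toEquiv.eq_symm_apply.symm

/-- The elements of `W` whose fixed space is a translate of `L` under `W`. -/
def fixConjSet (W : Subgroup (E ≃ₗᵢ[ℝ] E)) (L : Submodule ℝ E) : Set (E ≃ₗᵢ[ℝ] E) :=
  {w | w ∈ W ∧ ∃ g ∈ W, image g L = fixedSpace w}

theorem finite_fixConjSet [Finite W] : (fixConjSet W L).Finite :=
  (Set.toFinite (W : Set (E ≃ₗᵢ[ℝ] E))).subset fun _ hw => hw.1

theorem fixedSpace_eq_mirrorFlat (hW : IsFiniteReflectionGroup W) (hx : x₀ ∈ mirrorCompl W)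
    {w : E ≃ₗᵢ[ℝ] E} (hw : w ∈ W) {u : E} (hu : IsGenericIn W (fixedSpace w) u) :
    fixedSpace w = mirrorFlat W u :=
  le_antisymm hu.2 fun _ hy => mem_fixedSpace.mpr
    ((mem_pointFixer_mirrorFlat hW hx hw (mem_fixedSpace.mp hu.1)).2 _ hy)

theorem pairwiseDisjoint_fixConjSet {C : PointedCone ℝ E} {k : ℕ} {R : Finset (PointedCone ℝ E)}
    (hR : IsFaceTransversal W C k R) :
    (R : Set (PointedCone ℝ E)).PairwiseDisjoint fun F => fixConjSet W (linSpan F) := by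
  refine fun F hF F' hF' hne => Set.disjoint_left.mpr ?_
  rintro w ⟨-, g, hg, hgF⟩ ⟨-, g', hg', hgF'⟩
  refine hne ((hR.2 F (hR.1 F hF)).unique ⟨hF, 1, W.one_mem, image_one _⟩
    ⟨hF', g'⁻¹ * g, W.mul_mem (W.inv_mem hg') hg, ?_⟩)
  rw [image_mul, hgF, image_inv_of_eq hgF']

variable [FiniteDimensional ℝ E]

theorem mem_regSet_iff {w : E ≃ₗᵢ[ℝ] E} : w ∈ regSet W L ↔ w ∈ W ∧ fixedSpace w = L := by
  constructor
  · rintro ⟨hw, hbot⟩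
    have hle : L ≤ fixedSpace w := fun u hu => mem_fixedSpace.mpr (hw.2 u hu)
    have hsup := Submodule.sup_orthogonal_inf_of_hasOrthogonalProjection hle
    rw [inf_comm, hbot, sup_bot_eq] at hsup
    exact ⟨hw.1, hsup.symm⟩
  · rintro ⟨hw, rfl⟩
    exact ⟨⟨hw, fun u hu => mem_fixedSpace.mp hu⟩, (Submodule.orthogonal_disjoint _).eq_bot⟩

theorem card_fixedSpace_eq_image {g : E ≃ₗᵢ[ℝ] E} (hg : g ∈ W) :
    Nat.card {w : fixConjSet W L // image g L = fixedSpace (w : E ≃ₗᵢ[ℝ] E)} =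
      Nat.card (regSet W L) :=
  Nat.card_congr {
    toFun w := ⟨g⁻¹ * w * g, mem_regSet_iff.mpr
      ⟨W.mul_mem (W.mul_mem (W.inv_mem hg) w.1.2.1) hg, by
        have hconj := fixedSpace_conj g⁻¹ w
        rwa [inv_inv, image_inv_of_eq w.2] at hconj⟩⟩
    invFun r :=
      have hspace : image g L = fixedSpace (g * r.1 * g⁻¹) := by
        rw [fixedSpace_conj, (mem_regSet_iff.mp r.2).2]
      ⟨⟨g * r.1 * g⁻¹, W.mul_mem (W.mul_mem hg r.2.1.1) (W.inv_mem hg), g, hg, hspace⟩, hspace⟩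
    left_inv w := Subtype.ext (Subtype.ext (by simp only [mul_assoc]; group))
    right_inv r := Subtype.ext (by simp only [mul_assoc]; group) }

theorem card_fixConjSet_mul_card_normalizer [Finite W] (L : Submodule ℝ E) :
    Nat.card (fixConjSet W L) * Nat.card (normalizer W L) =
      Nat.card W * Nat.card (regSet W L) := by
  classical
  have := Fintype.ofFinite W
  have := (finite_fixConjSet (W := W) (L := L)).fintype
  rw [Nat.card_eq_fintype_card (α := fixConjSet W L), Nat.card_eq_fintype_card (α := W)]
  refine Finset.card_mul_eq_card_mul
    (fun (w : fixConjSet W L) (g : W) => image (g : E ≃ₗᵢ[ℝ] E) L = fixedSpace w.1) ?_ ?_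
  · rintro ⟨w, hw, g, hg, hgL⟩ -
    rw [← card_image_eq hg hgL, Nat.card_eq_fintype_card, Fintype.card_subtype]
    rfl
  · intro g _
    rw [← card_fixedSpace_eq_image g.2, Nat.card_eq_fintype_card, Fintype.card_subtype]
    rfl

theorem card_regSet_div_card_normalizer [Finite W] (L : Submodule ℝ E) :
    (Nat.card (regSet W L) : ℝ) / Nat.card (normalizer W L) =
      Nat.card (fixConjSet W L) / Nat.card W := by
  rw [div_eq_div_iff (Nat.cast_ne_zero.mpr card_normalizer_ne_zero)
    (Nat.cast_ne_zero.mpr Nat.card_pos.ne'), mul_comm]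
  exact_mod_cast (card_fixConjSet_mul_card_normalizer L).symm

theorem exists_isGenericIn [Finite W] (U : Submodule ℝ E) : ∃ u, IsGenericIn W U u := by
  borelize E
  obtain ⟨u, hu⟩ := (ae_isGenericIn (W := W) U).exists
  exact ⟨u, hu⟩

theorem exists_face_image_fixedSpace_eq (hW : IsFiniteReflectionGroup W)
    (hx : x₀ ∈ mirrorCompl W) {w : E ≃ₗᵢ[ℝ] E} (hw : w ∈ W) :
    ∃ F : PointedCone ℝ E, F.IsFaceOf (chamber W x₀) ∧
      ∃ g ∈ W, image g (fixedSpace w) = linSpan F := by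
  have := hW.finite
  obtain ⟨u, hu⟩ := exists_isGenericIn (W := W) (fixedSpace w)
  obtain ⟨g, hg, hgu⟩ := exists_map_mem_chamber (W := W) x₀ u
  obtain ⟨F, hF, hspan⟩ := exists_face_linSpan_eq_mirrorFlat hx hgu
  exact ⟨F, hF, g, hg, by
    rw [fixedSpace_eq_mirrorFlat hW hx hw hu, image_mirrorFlat hg, hspan]⟩

theorem fixDimSet_eq_iUnion (hW : IsFiniteReflectionGroup W) (hx : x₀ ∈ mirrorCompl W) {k : ℕ}
    {R : Finset (PointedCone ℝ E)} (hR : IsFaceTransversal W (chamber W x₀) k R) :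
    fixDimSet W k = ⋃ F ∈ R, fixConjSet W (linSpan F) := by
  refine Set.Subset.antisymm (fun w ⟨hw, hk⟩ => ?_) (Set.iUnion₂_subset fun F hF w hw => ?_)
  · obtain ⟨F, hF, g, hg, hgF⟩ := exists_face_image_fixedSpace_eq hW hx hw
    obtain ⟨F', ⟨hF', h, hh, hhF'⟩, -⟩ := hR.2 F ⟨hF, by rw [← hgF, finrank_image, hk]⟩
    refine Set.mem_biUnion hF' ⟨hw, (h * g)⁻¹, W.inv_mem (W.mul_mem hh hg), image_inv_of_eq ?_⟩
    rw [image_mul, hgF, hhF']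
  · obtain ⟨hw, g, -, hgF⟩ := hw
    exact ⟨hw, by rw [← hgF, finrank_image, (hR.1 F hF).2]⟩

theorem card_fixDimSet (hW : IsFiniteReflectionGroup W) (hx : x₀ ∈ mirrorCompl W) {k : ℕ}
    {R : Finset (PointedCone ℝ E)} (hR : IsFaceTransversal W (chamber W x₀) k R) :
    Nat.card (fixDimSet W k) = ∑ F ∈ R, Nat.card (fixConjSet W (linSpan F)) := by
  have := hW.finite
  rw [fixDimSet_eq_iUnion hW hx hR, Nat.card_coe_set_eq,
    ← finsum_mem_coe_finset]
  exact R.finite_toSet.ncard_biUnion (fun _ _ => finite_fixConjSet) (pairwiseDisjoint_fixConjSet hR)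

end Counting

end AngleMeasure

end

open AngleMeasure in
theorem mainTheorem2 {V : Type*} [NormedAddCommGroup V] [InnerProductSpace ℝ V]
    [FiniteDimensional ℝ V] [MeasurableSpace V] [BorelSpace V]
    (W : Subgroup (V ≃ₗᵢ[ℝ] V)) (hW : IsFiniteReflectionGroup W)
    (C : PointedCone ℝ V) (hC : IsFundamentalCone W C) (k : ℕ) :
    (faces C k).Finite ∧
    (∀ F ∈ faces C k,
      classAngle W C F k =
        (Nat.card (pointFixer W (linSpan F)) : ℝ) / Nat.card (normalizer W (linSpan F))) ∧
    (∀ R : Finset (PointedCone ℝ V), IsFaceTransversal W C k R →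
      ∑ F ∈ R, (Nat.card (regSet W (linSpan F)) : ℝ) / Nat.card (normalizer W (linSpan F)) =
        ∑ F ∈ R, classAngle W C F k *
          relAngle (dualCone (quotCone C F)) ∧
      ∑ F ∈ R, classAngle W C F k *
          relAngle (dualCone (quotCone C F)) =
        (Nat.card (fixDimSet W k) : ℝ) / Nat.card W) := by
  have := hW.finite
  obtain ⟨x₀, hx, rfl⟩ := hC.exists_eq_chamber
  refine ⟨finite_faces hx k, fun F hF => classAngle_eq_div hW hx hF, fun R hR => ?_⟩
  have hangle := Finset.sum_congr rfl fun F hF =>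
    classAngle_mul_relAngle_dualCone hW hx (hR.1 F hF)
  refine ⟨hangle.symm, hangle.trans ?_⟩
  rw [card_fixDimSet hW hx hR, Nat.cast_sum, Finset.sum_div]
  exact Finset.sum_congr rfl fun F _ => card_regSet_div_card_normalizer (linSpan F)
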